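/- **Setting.** Let $\Theta\subseteq\mathbb R^p$ be closed without isolated points, let $\Upsilon\subseteq\mathbb R^m$ be measurable, and let $\nu$ be a $\sigma$-finite reference measure on $\mathbb R^m$ (Lebesgue measure for continuous observations, a sum of point masses for discrete ones). The parameter $\theta\in\Theta$ has a Lebesgue density $p(\theta)$ on $\Theta$, the observation $X\in\Upsilon$ has, given $\theta$, a $\nu$-density $p(x\mid\theta)$ on $\Upsilon$, and $p(x,\theta)=p(x\mid\theta)p(\theta)$. Gradients and Jacobians are with respect to $\theta$ and are taken at interior points of $\Theta$; $\mathbb E$ without further specification is expectation for $(\theta,X)\sim p(x,\theta)$. For a function $g$ on $\Theta$, "$g(\theta)\to0$ at $\partial\Theta^+$" means that $g(\theta)\to 0$ as $\theta\in\Theta\setminus\{b\}$ tends to $b$, for every boundary point $b$ of $\Theta$, and also as $\theta\in\Theta$, $\|\theta\|\to\infty$ (if $\Theta$ is unbounded). **Models.** Let $\mathcal S_P\subset\mathbb R^{q_P}$, $\mathcal S_F\subset\mathbb R^{q_F}$ be compact parameter sets, and let $s_P(\theta;\Omega)\in\mathbb R^p$ $(\Omega\in\mathcal S_P)$ and $s_F(x\mid\theta;\Omega)\in\mathbb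 R^p$ $(\Omega\in\mathcal S_F)$ be the prior and the Fisher score networks, measurable in $\theta$, respectively in $(x,\theta)$, for each $\Omega$. Put $$\mathcal L_P(\Omega)=\mathbb E\|s_P(\theta;\Omega)-\nabla\log p(\theta)\|_2^2,\qquad \mathcal L_F(\Omega)=\mathbb E\|s_F(X\mid\theta;\Omega)-\nabla\log p(X\mid\theta)\|_2^2 .$$ **Data.** Let $K\ge1$ and let $(\theta_n,(X_{n,j})_{j=1}^{K})$, $n\ge1$, be i.i.d. records, where $\theta_n\sim p(\theta)$ and, given $\theta_n$, the $X_{n,j}$ are i.i.d. with density $p(\cdot\mid\theta_n)$. The data set $\mathcal D$ consists of the first $N_D$ records. Put $$\widehat{\mathcal L}_P(\Omega)=\frac1{N_D}\sum_{n}\Big(\|s_P(\theta_n;\Omega)\|_2^2+2\operatorname{tr}\frac{\partial s_P(\theta_n;\Omega)}{\partial\theta}\Big),$$ $$\widehat{\mathcal L}_F(\Omega;\Omega_P)=\frac1{N_DK}\sum_{n,j}\Big(\|s_F(X_{n,j}\mid\theta_n;\Omega)\|_2^2+2\,s_F(X_{n,j}\mid\theta_n;\Omega)^Ts_P(\theta_n;\Omega_P)+2\operatorname{tr}\frac{\partial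 s_F(X_{n,j}\mid\theta_n;\Omega)}{\partial\theta}\Big).$$ **Assumptions.** 1. (Bayesian Cramér–Rao regularity.) Where the densities are positive, $\nabla\log p(x,\theta)$ and $\nabla\log p(\theta)$ exist; the components of $\nabla\log p(X,\theta)$ are integrable under the joint law; the matrix $\mathbb E[\nabla\log p(X,\theta)\nabla\log p(X,\theta)^T]$ is finite and positive definite; for all $x\in\Upsilon$, $\theta\,p(x,\theta)\to0$ at $\partial\Theta^+$; $\mathbb E[\nabla\log p(X,\theta)\mid X=x]=0$ for all $x\in\Upsilon$ with positive (finite) marginal density; and $\{x\in\Upsilon:p(x,\theta)>0\}$ is the same set for all $\theta$ in the interior of $\Theta$. 2. (Prior score matching regularity.) $\log p(\theta)$ is differentiable where $p(\theta)>0$; for each $\Omega\in\mathcal S_P$, $s_P(\cdot\,;\Omega)$ is differentiable, $\mathbb E\|s_P(\theta;\Omega)\|_2^2<\infty$, and $s_P(\theta;\Omega)p(\theta)\to0$ at $\partial\Theta^+$; and $\mathbb E\|\nabla\log p(\theta)\|_2^2<\infty$. 3. (Fisher score matching regularity.) $\log p(x\mid\theta)$ is differentiable in $\theta$ where $p(x,\theta)>0$;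 for each $\Omega\in\mathcal S_F$, $s_F(x\mid\theta;\Omega)$ is differentiable in $\theta$, $\mathbb E\|s_F(X\mid\theta;\Omega)\|_2^2<\infty$, and $s_F(x\mid\theta;\Omega)p(x,\theta)\to0$ at $\partial\Theta^+$ for all $x\in\Upsilon$; and $\mathbb E\|\nabla\log p(X\mid\theta)\|_2^2<\infty$. 4. (Lipschitz continuity.) For $\alpha=P$ (with $z=\theta$) and $\alpha=F$ (with $z=(\theta,x)$) there are functions $\xi_\alpha,\tau_\alpha,\zeta_\alpha$ with $\mathbb E[\xi_\alpha(Z)^2],\ \mathbb E|\tau_\alpha(Z)|,\ \mathbb E|\zeta_\alpha(Z)|<\infty$ such that for all $z$ with $\theta$ interior to $\Theta$ (and $x\in\Upsilon$) and all $\Omega_1,\Omega_2\in\mathcal S_\alpha$, writing $s_i=s_\alpha(z;\Omega_i)$, $$\|s_1-s_2\|_2\le\xi_\alpha(z)\|\Omega_1-\Omega_2\|_2,\quad \Big\|\frac{\partial s_1}{\partial\theta}-\frac{\partial s_2}{\partial\theta}\Big\|_2\le\tau_\alpha(z)\|\Omega_1-\Omega_2\|_2,\quad \|s_1s_1^T-s_2s_2^T\|_F\le\zeta_\alpha(z)\|\Omega_1-\Omega_2\|_2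 ,$$ where the matrix norm $\|\cdot\|_2$ is the spectral norm and $\|\cdot\|_F$ is the Frobenius norm. 5. (Realizability.) There is $\Omega\in\mathcal S_P$ with $s_P(\theta;\Omega)=\nabla\log p(\theta)$ at all interior $\theta$ with $p(\theta)>0$, and $\Omega\in\mathcal S_F$ with $s_F(x\mid\theta;\Omega)=\nabla\log p(x\mid\theta)$ at all $x\in\Upsilon$ and interior $\theta$ with $p(x,\theta)>0$. 6. (Global minimizers.) Almost surely, for every $N_D\ge1$, $\Omega_P^*$ minimizes $\widehat{\mathcal L}_P$ over $\mathcal S_P$ and $\Omega_F^*$ minimizes $\widehat{\mathcal L}_F(\,\cdot\,;\Omega_P^*)$ over $\mathcal S_F$. **Theorem (Measurement and Prior Score Consistency).** Under these assumptions, $$\mathcal L_F(\Omega_F^*)\to0\quad\text{and}\quad\mathcal L_P(\Omega_P^*)\to0\qquad\text{almost surely as }N_D\to\infty .$$ -/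

import Mathlib

open MeasureTheory ProbabilityTheory Filter Topology

noncomputable section

namespace ScoreMatching

/-- `ℝⁿ` with the Euclidean norm. -/
abbrev Vec (n : ℕ) : Type := EuclideanSpace ℝ (Fin n)

/-- A Bayesian model: a random parameter in `paramSet ⊆ ℝ^p` with density `prior` with respect to
Lebesgue measure, and an observation in `obsSet ⊆ ℝ^m` with conditional density `lik x θ = p(x | θ)`
with respect to a reference measure `ref` (Lebesgue measure for a continuous observation, a sum of
point masses for a discrete one, or a mixture of the two kinds). -/
structure BayesModel (p m : ℕ) where
  paramSet : Set (Vec p)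
  paramSet_perfect : Perfect paramSet
  obsSet : Set (Vec m)
  obsSet_measurable : MeasurableSet obsSet
  ref : Measure (Vec m)
  ref_sigmaFinite : SigmaFinite ref
  prior : Vec p → ℝ
  prior_measurable : Measurable prior
  prior_nonneg : ∀ θ, 0 ≤ prior θ
  prior_lintegral : ∫⁻ θ in paramSet, ENNReal.ofReal (prior θ) = 1
  lik : Vec m → Vec p → ℝ
  lik_measurable : Measurable (fun z : Vec p × Vec m => lik z.2 z.1)
  lik_nonneg : ∀ x θ, 0 ≤ lik x θ
  lik_lintegral : ∀ θ ∈ paramSet, 0 < prior θ →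
    ∫⁻ x in obsSet, ENNReal.ofReal (lik x θ) ∂ref = 1

attribute [instance] BayesModel.ref_sigmaFinite

/-- `g(θ) → 0` as `θ → ∂Θ⁺`, i.e. as `θ ∈ Θ` tends to any boundary point of `Θ`, or to infinity
(the second clause is void if `Θ` is bounded). -/
def VanishesAtBoundary {p : ℕ} (Θ : Set (Vec p)) (g : Vec p → Vec p) : Prop :=
  (∀ b ∈ frontier Θ, Tendsto g (𝓝[Θ \ {b}] b) (𝓝 0)) ∧
    Tendsto g (Bornology.cobounded (Vec p) ⊓ 𝓟 Θ) (𝓝 0)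

/-- The outer product `u uᵀ`. -/
def outer {p : ℕ} (u : Vec p) : Matrix (Fin p) (Fin p) ℝ := Matrix.of fun i j => u i * u j

/-- The Frobenius norm. -/
def frobNorm {p : ℕ} (A : Matrix (Fin p) (Fin p) ℝ) : ℝ := √(∑ i, ∑ j, A i j ^ 2)

/-- The trace of the Jacobian matrix of `s` at `θ`. -/
def jacTrace {p : ℕ} (s : Vec p → Vec p) (θ : Vec p) : ℝ :=
  LinearMap.trace ℝ (Vec p) (fderiv ℝ s θ : Vec p →ₗ[ℝ] Vec p)

/-- Lipschitz continuity in the network parameter, uniformly over `S`, of a score model `s`, of its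
Jacobian `J` (in operator norm, which is the spectral norm) and of `s sᵀ` (in Frobenius norm), with
moment bounds on the Lipschitz constants under the law of `z`. -/
def LipschitzScore {p q : ℕ} {Z : Type*} [MeasurableSpace Z] (law : Measure Z) (D : Set Z)
    (S : Set (Vec q)) (s : Vec q → Z → Vec p) (J : Vec q → Z → (Vec p →L[ℝ] Vec p)) : Prop :=
  ∃ ξ τ ζ : Z → ℝ,
    (∀ z ∈ D, ∀ Ω₁ ∈ S, ∀ Ω₂ ∈ S,
      ‖s Ω₁ z - s Ω₂ z‖ ≤ ξ z * ‖Ω₁ - Ω₂‖ ∧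
      ‖J Ω₁ z - J Ω₂ z‖ ≤ τ z * ‖Ω₁ - Ω₂‖ ∧
      frobNorm (outer (s Ω₁ z) - outer (s Ω₂ z)) ≤ ζ z * ‖Ω₁ - Ω₂‖) ∧
    MemLp ξ 2 law ∧ Integrable τ law ∧ Integrable ζ law

namespace BayesModel

variable {p m : ℕ} (M : BayesModel p m)

/-- The joint density `p(x, θ) = p(x | θ) p(θ)`. -/
def joint (x : Vec m) (θ : Vec p) : ℝ := M.lik x θ * M.prior θ

/-- The density of the observation. -/
def evidence (x : Vec m) : ℝ := ∫ θ in M.paramSet, M.joint x θ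

/-- The posterior density `p(θ | x)`. -/
def posterior (x : Vec m) (θ : Vec p) : ℝ := M.joint x θ / M.evidence x

/-- The law of the parameter. -/
def priorLaw : Measure (Vec p) :=
  (volume.restrict M.paramSet).withDensity fun θ => ENNReal.ofReal (M.prior θ)

/-- The joint law of the pair (parameter, observation). -/
def jointLaw : Measure (Vec p × Vec m) :=
  ((volume.restrict M.paramSet).prod (M.ref.restrict M.obsSet)).withDensity
    fun z => ENNReal.ofReal (M.joint z.2 z.1)

/-- The law of one record of the data set: a parameter `θ` drawn from the prior, with `K`
observations that are i.i.d. given `θ`. -/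
def recordLaw (K : ℕ) : Measure (Vec p × (Fin K → Vec m)) :=
  ((volume.restrict M.paramSet).prod (Measure.pi fun _ => M.ref.restrict M.obsSet)).withDensity
    fun z => ENNReal.ofReal (M.prior z.1 * ∏ j, M.lik (z.2 j) z.1)

/-- The prior score `∇_θ log p(θ)`. -/
def priorScore (θ : Vec p) : Vec p := gradient (fun t => Real.log (M.prior t)) θ

/-- The Fisher score `∇_θ log p(x | θ)`. -/
def fisherScore (x : Vec m) (θ : Vec p) : Vec p := gradient (fun t => Real.log (M.lik x t)) θ

/-- The Bayesian score `∇_θ log p(x, θ)`. -/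
def jointScore (x : Vec m) (θ : Vec p) : Vec p := gradient (fun t => Real.log (M.joint x t)) θ

/-- The Bayesian Fisher information matrix of a single observation. -/
def bfim : Matrix (Fin p) (Fin p) ℝ :=
  Matrix.of fun i j => ∫ z, M.jointScore z.2 z.1 i * M.jointScore z.2 z.1 j ∂M.jointLaw

/-- The regularity conditions of the Bayesian Cramér–Rao bound. Gradients are taken at interior
points of the parameter set. -/
structure BCRBRegular : Prop where
  joint_diff : ∀ x ∈ M.obsSet, ∀ θ ∈ interior M.paramSet, 0 < M.joint x θ →
    DifferentiableAt ℝ (fun t => Real.log (M.joint x t)) θ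
  joint_integrable : ∀ i, Integrable (fun z => M.jointScore z.2 z.1 i) M.jointLaw
  prior_diff : ∀ θ ∈ interior M.paramSet, 0 < M.prior θ →
    DifferentiableAt ℝ (fun t => Real.log (M.prior t)) θ
  bfim_finite : ∀ i j,
    Integrable (fun z => M.jointScore z.2 z.1 i * M.jointScore z.2 z.1 j) M.jointLaw
  bfim_posDef : M.bfim.PosDef
  boundary : ∀ x ∈ M.obsSet, VanishesAtBoundary M.paramSet fun θ => M.joint x θ • θ
  score_mean : ∀ x ∈ M.obsSet, 0 < M.evidence x →
    IntegrableOn (fun θ => M.posterior x θ • M.jointScore x θ) M.paramSet ∧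
      ∫ θ in M.paramSet, M.posterior x θ • M.jointScore x θ = 0
  common_support : ∃ U ⊆ M.obsSet, ∀ θ ∈ interior M.paramSet,
    {x | x ∈ M.obsSet ∧ 0 < M.joint x θ} = U

/-- Regularity for matching the prior score by the family `sP Ω`, `Ω ∈ S`: differentiability, finite
second moments and the boundary condition. -/
structure PriorScoreRegular {q : ℕ} (S : Set (Vec q)) (sP : Vec q → Vec p → Vec p) : Prop where
  prior_diff : ∀ θ ∈ interior M.paramSet, 0 < M.prior θ →
    DifferentiableAt ℝ (fun t => Real.log (M.prior t)) θ
  model_measurable : ∀ Ω ∈ S, Measurable (sP Ω)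
  model_diff : ∀ Ω ∈ S, ∀ θ ∈ interior M.paramSet, DifferentiableAt ℝ (sP Ω) θ
  model_sq : ∀ Ω ∈ S, Integrable (fun θ => ‖sP Ω θ‖ ^ 2) M.priorLaw
  score_sq : Integrable (fun θ => ‖M.priorScore θ‖ ^ 2) M.priorLaw
  boundary : ∀ Ω ∈ S, VanishesAtBoundary M.paramSet fun θ => M.prior θ • sP Ω θ

/-- Regularity for matching the Fisher score by the family `sF Ω`, `Ω ∈ S`: differentiability,
finite second moments and the boundary condition. -/
structure FisherScoreRegular {q : ℕ} (S : Set (Vec q)) (sF : Vec q → Vec m → Vec p → Vec p) :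
    Prop where
  lik_diff : ∀ x ∈ M.obsSet, ∀ θ ∈ interior M.paramSet, 0 < M.joint x θ →
    DifferentiableAt ℝ (fun t => Real.log (M.lik x t)) θ
  model_measurable : ∀ Ω ∈ S, Measurable (fun z : Vec p × Vec m => sF Ω z.2 z.1)
  model_diff : ∀ Ω ∈ S, ∀ x ∈ M.obsSet, ∀ θ ∈ interior M.paramSet,
    DifferentiableAt ℝ (sF Ω x) θ
  model_sq : ∀ Ω ∈ S, Integrable (fun z => ‖sF Ω z.2 z.1‖ ^ 2) M.jointLaw
  score_sq : Integrable (fun z => ‖M.fisherScore z.2 z.1‖ ^ 2) M.jointLaw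
  boundary : ∀ Ω ∈ S, ∀ x ∈ M.obsSet,
    VanishesAtBoundary M.paramSet fun θ => M.joint x θ • sF Ω x θ

/-- Lipschitz continuity of the prior score model. -/
def PriorLipschitz {q : ℕ} (S : Set (Vec q)) (sP : Vec q → Vec p → Vec p) : Prop :=
  LipschitzScore M.priorLaw (interior M.paramSet) S sP fun Ω θ => fderiv ℝ (sP Ω) θ

/-- Lipschitz continuity of the Fisher score model; the Jacobian is taken in `θ`. -/
def FisherLipschitz {q : ℕ} (S : Set (Vec q)) (sF : Vec q → Vec m → Vec p → Vec p) : Prop :=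
  LipschitzScore M.jointLaw (interior M.paramSet ×ˢ M.obsSet) S (fun Ω z => sF Ω z.2 z.1)
    fun Ω z => fderiv ℝ (sF Ω z.2) z.1

/-- The true prior score belongs to the family. -/
def PriorRealizable {q : ℕ} (S : Set (Vec q)) (sP : Vec q → Vec p → Vec p) : Prop :=
  ∃ Ω ∈ S, ∀ θ ∈ interior M.paramSet, 0 < M.prior θ → sP Ω θ = M.priorScore θ

/-- The true Fisher score belongs to the family. -/
def FisherRealizable {q : ℕ} (S : Set (Vec q)) (sF : Vec q → Vec m → Vec p → Vec p) : Prop :=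
  ∃ Ω ∈ S, ∀ x ∈ M.obsSet, ∀ θ ∈ interior M.paramSet, 0 < M.joint x θ →
    sF Ω x θ = M.fisherScore x θ

/-- The prior score mismatch `L_P(Ω)`. -/
def priorMismatch {q : ℕ} (sP : Vec q → Vec p → Vec p) (Ω : Vec q) : ℝ :=
  ∫ θ, ‖sP Ω θ - M.priorScore θ‖ ^ 2 ∂M.priorLaw

/-- The Fisher score mismatch `L_F(Ω)`. -/
def fisherMismatch {q : ℕ} (sF : Vec q → Vec m → Vec p → Vec p) (Ω : Vec q) : ℝ :=
  ∫ z, ‖sF Ω z.2 z.1 - M.fisherScore z.2 z.1‖ ^ 2 ∂M.jointLaw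

end BayesModel

/-- The per-sample prior score-matching loss. -/
def priorLoss {p q : ℕ} (sP : Vec q → Vec p → Vec p) (θ : Vec p) (Ω : Vec q) : ℝ :=
  ‖sP Ω θ‖ ^ 2 + 2 * jacTrace (sP Ω) θ

/-- The per-sample Fisher score-matching loss, with `ΩP` the parameter of the prior score model. -/
def fisherLoss {p m qF qP : ℕ} (sF : Vec qF → Vec m → Vec p → Vec p) (sP : Vec qP → Vec p → Vec p)
    (x : Vec m) (θ : Vec p) (ΩF : Vec qF) (ΩP : Vec qP) : ℝ :=
  ‖sF ΩF x θ‖ ^ 2 + 2 * inner ℝ (sF ΩF x θ) (sP ΩP θ) + 2 * jacTrace (sF ΩF x) θ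

/-- The empirical prior score-matching objective over the first `N` records. -/
def empPriorLoss {p m K q : ℕ} (sP : Vec q → Vec p → Vec p)
    (data : ℕ → Vec p × (Fin K → Vec m)) (N : ℕ) (Ω : Vec q) : ℝ :=
  (1 / (N : ℝ)) * ∑ n ∈ Finset.range N, priorLoss sP (data n).1 Ω

/-- The empirical Fisher score-matching objective over the first `N` records. -/
def empFisherLoss {p m K qF qP : ℕ} (sF : Vec qF → Vec m → Vec p → Vec p)
    (sP : Vec qP → Vec p → Vec p) (data : ℕ → Vec p × (Fin K → Vec m)) (N : ℕ)
    (ΩP : Vec qP) (ΩF : Vec qF) : ℝ :=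
  (1 / ((N : ℝ) * (K : ℝ))) * ∑ n ∈ Finset.range N, ∑ j : Fin K,
    fisherLoss sF sP ((data n).2 j) (data n).1 ΩF ΩP

end ScoreMatching

end

open ScoreMatching

/-!
The two networks are trained on score-matching losses which, up to terms that do not depend on the
network, are unbiased for the score mismatches, provided that the Fisher loss is computed with the
true prior score. The proof makes this precise and then runs the
classical argument for the consistency of minimizers over a compact parameter set.

Write `G` for the interior of the parameter set and `s'` for the network that realizes the true
score. The trace of the Jacobian of a single network need not be integrable, so everything is done
with the *excess* loss of a network `s` over `s'`: the Lipschitz condition bounds the difference of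
the two Jacobians by an integrable function. With `D = s - s'`,
`‖s‖² - ‖s'‖² + 2 (tr ∂s - tr ∂s') = ‖D‖² + 2 (tr ∂D + ⟪D, s'⟫)`,
and the expectation of `tr ∂D + ⟪D, s'⟫` is the integral over `G` of the divergence of `w D`, with
`w` the density whose logarithmic gradient is `s'`. In the Fisher loss `w` is the joint density at a
fixed observation, and the prior score is added to `s'`.

This divergence integrates to zero (`setIntegral_weighted_divergence_eq_zero`) although the boundary
of `G` may be arbitrarily rough and the derivatives discontinuous. Each component `F` of `w D` is
integrable with integrable partial derivatives and vanishes at the boundary of `G`; a truncation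
that is zero near the value `0` turns `F` into a function that is differentiable on the whole space,
to which integration by parts applies, and the truncation is removed by dominated convergence.
Since the truncation acts on each component separately, this uses the integrability of the partial
derivatives of `w D` and not only of its divergence; the Lipschitz condition on the full Jacobian
provides it.

Two facts about the model are needed to pass to `G`. The boundary condition on `p(x, θ) θ` forces
the prior to vanish almost everywhere on the boundary of the parameter set, which may have positive
volume (`BayesModel.ae_mem_interior_or_prior_eq_zero`). The common support condition forces the
prior to be positive on all of `G` (`BayesModel.exists_common_support`), so that `w` is
differentiable there and no mass is lost at zeros of `w` inside `G`.

Hence the expected excess prior loss is the prior mismatch (`BayesModel.integral_priorLoss_sub`).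
In the Fisher loss the learned prior network replaces the true prior score; the resulting cross term
is absorbed, which bounds the Fisher mismatch by twice the expected excess Fisher loss plus four
times the prior mismatch (`BayesModel.fisherMismatch_le`). The empirical excess losses converge to
their expectations uniformly over the compact parameter sets
(`ae_eventually_forall_abs_average_sub_le`). For the Fisher loss the uniformity is over both
parameters jointly, because the prior network changes with the sample. At a minimizer the empirical
excess loss is nonpositive, so the prior mismatch tends to zero, and then the Fisher mismatch does.
-/

namespace ScoreMatching

/-! ### Integrals of derivatives of functions vanishing at the boundary of an open set -/

section Divergence

/-- A set all of whose points are isolated is countable. -/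
theorem countable_of_isolated {X : Type*} [TopologicalSpace X] [SecondCountableTopology X]
    {s : Set X} (h : ∀ x ∈ s, ∀ᶠ y in 𝓝[≠] x, y ∉ s) : s.Countable := by
  have : DiscreteTopology s := by
    rw [discreteTopology_subtype_iff]
    intro x hx
    rw [← disjoint_iff, disjoint_principal_right]
    exact h x hx
  exact Set.countable_coe_iff.1 (TopologicalSpace.separableSpace_iff_countable.1 inferInstance)

theorem countable_setOf_zero_deriv_ne_zero (g : ℝ → ℝ) :
    {t | g t = 0 ∧ deriv g t ≠ 0}.Countable := by
  refine countable_of_isolated fun t ht => ?_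
  have hd : DifferentiableAt ℝ g t := by
    by_contra h
    exact ht.2 (deriv_zero_of_not_differentiableAt h)
  filter_upwards [hd.hasDerivAt.eventually_ne (c := 0) ht.2] with y hy hy'
  exact hy hy'.1

variable {E : Type*} [NormedAddCommGroup E] [NormedSpace ℝ E] [FiniteDimensional ℝ E]
  [MeasurableSpace E] [BorelSpace E] {μ : Measure E} [μ.IsAddHaarMeasure]

/-- On almost all of its zero set, a function differentiable on `G` has vanishing derivative in the
direction `v`: on each line parallel to `v`, the zeros with nonzero derivative are isolated. -/
theorem ae_fderiv_apply_eq_zero_of_eq_zero {F : E → ℝ} (hF : Measurable F) {G : Set E}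
    (hG : IsOpen G) (hd : ∀ x ∈ G, DifferentiableAt ℝ F x) (v : E) :
    ∀ᵐ x ∂μ, x ∈ G → F x = 0 → fderiv ℝ F x v = 0 := by
  have hm : MeasurableSet {x | x ∈ G → F x = 0 → fderiv ℝ F x v = 0} := by
    have h1 : Measurable fun x => fderiv ℝ F x v := measurable_fderiv_apply_const ℝ F v
    exact measurableSet_setOfPred.2 <| (measurableSet_setOfPred.1 hG.measurableSet).imp
      ((measurableSet_setOfPred.1 (hF (measurableSet_singleton 0))).imp
        (measurableSet_setOfPred.1 (h1 (measurableSet_singleton 0))))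
  refine ae_mem_of_ae_add_linearMap_mem (LinearMap.toSpanSingleton ℝ E v) volume μ hm fun y => ?_
  have hc := (countable_setOf_zero_deriv_ne_zero fun t : ℝ => F (y + t • v)).ae_notMem volume
  filter_upwards [hc] with t ht hG' h0
  simp only [LinearMap.toSpanSingleton_apply] at hG' h0 ⊢
  by_contra hne
  refine ht ⟨h0, ?_⟩
  have h2 : HasDerivAt (fun t : ℝ => y + t • v) v t := by
    simpa using ((hasDerivAt_id t).smul_const v).const_add y
  have := (hd _ hG').hasFDerivAt.comp_hasDerivAt t h2
  rw [show (fun t : ℝ => F (y + t • v)) = F ∘ (fun t : ℝ => y + t • v) from rfl, this.deriv]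
  exact hne

/-- A continuous cutoff: `0` for `|s| ≤ ε`, `1` for `|s| ≥ 2 ε`, and affine in `|s|` in between. -/
noncomputable def softCut (ε s : ℝ) : ℝ := max 0 (min 1 (|s| / ε - 1))

/-- The primitive of `softCut ε`: a `C¹` function that vanishes on `[-ε, ε]` and approximates the
identity as `ε → 0`. -/
noncomputable def softTrunc (ε t : ℝ) : ℝ := ∫ s in (0 : ℝ)..t, softCut ε s

theorem continuous_softCut (ε : ℝ) : Continuous (softCut ε) := by
  unfold softCut; fun_prop

theorem softCut_nonneg (ε s : ℝ) : 0 ≤ softCut ε s := le_max_left _ _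

theorem softCut_le_one (ε s : ℝ) : softCut ε s ≤ 1 := max_le zero_le_one (min_le_left _ _)

theorem softCut_eq_zero {ε s : ℝ} (hε : 0 < ε) (h : |s| ≤ ε) : softCut ε s = 0 := by
  have : |s| / ε ≤ 1 := (div_le_one hε).2 h
  exact max_eq_left ((min_le_right _ _).trans (by linarith))

theorem softCut_eq_one {ε s : ℝ} (hε : 0 < ε) (h : 2 * ε ≤ |s|) : softCut ε s = 1 := by
  have : 2 ≤ |s| / ε := (le_div_iff₀ hε).2 h
  unfold softCut
  rw [min_eq_left (by linarith), max_eq_right zero_le_one]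

theorem hasDerivAt_softTrunc (ε t : ℝ) : HasDerivAt (softTrunc ε) (softCut ε t) t :=
  intervalIntegral.integral_hasDerivAt_right ((continuous_softCut ε).intervalIntegrable _ _)
    (continuous_softCut ε).stronglyMeasurable.stronglyMeasurableAtFilter
    (continuous_softCut ε).continuousAt

theorem continuous_softTrunc (ε : ℝ) : Continuous (softTrunc ε) :=
  continuous_iff_continuousAt.2 fun t => (hasDerivAt_softTrunc ε t).continuousAt

theorem abs_softTrunc_le (ε t : ℝ) : |softTrunc ε t| ≤ |t| := by
  unfold softTrunc
  have := intervalIntegral.norm_integral_le_of_norm_le_const (a := 0) (b := t) (C := 1)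
    (f := softCut ε) fun s _ => by
      rw [Real.norm_of_nonneg (softCut_nonneg _ _)]; exact softCut_le_one _ _
  simpa using this

theorem softTrunc_eq_zero {ε t : ℝ} (hε : 0 < ε) (h : |t| ≤ ε) : softTrunc ε t = 0 := by
  unfold softTrunc
  rw [intervalIntegral.integral_congr (g := fun _ => 0), intervalIntegral.integral_zero]
  intro s hs
  refine softCut_eq_zero hε (le_trans ?_ h)
  simpa using Set.abs_sub_left_of_mem_uIcc hs

/-- A function on an open set `G` that tends to zero at the boundary, and is integrable together
with its derivative in direction `v`, has a derivative of integral zero. No regularity of the boundary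
of `G` and no continuity of the derivative is assumed. -/
theorem setIntegral_fderiv_eq_zero {F : E → ℝ} {G : Set E} (hG : IsOpen G)
    (hd : ∀ x ∈ G, DifferentiableAt ℝ F x) (hb : ∀ x, x ∉ G → Tendsto F (𝓝[G] x) (𝓝 0))
    (hi : IntegrableOn F G μ) (v : E) (hi' : IntegrableOn (fun x => fderiv ℝ F x v) G μ) :
    ∫ x in G, fderiv ℝ F x v ∂μ = 0 := by
  set g : E → ℝ := G.indicator F with hg
  have hgG : ∀ x ∈ G, g =ᶠ[𝓝 x] F := fun x hx => by
    filter_upwards [hG.mem_nhds hx] with y hy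
    exact Set.indicator_of_mem hy F
  have hgd : ∀ x ∈ G, HasFDerivAt g (fderiv ℝ F x) x := fun x hx =>
    (hd x hx).hasFDerivAt.congr_of_eventuallyEq (hgG x hx)
  have hg0 : ∀ x, x ∉ G → Tendsto g (𝓝 x) (𝓝 0) := by
    intro x hx
    rw [← nhdsWithin_univ, ← Set.union_compl_self G, nhdsWithin_union, tendsto_sup]
    refine ⟨(hb x hx).congr' ?_, tendsto_const_nhds.congr' ?_⟩
    · filter_upwards [self_mem_nhdsWithin] with y hy
      exact (Set.indicator_of_mem hy F).symm
    · filter_upwards [self_mem_nhdsWithin] with y hy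
      exact (Set.indicator_of_notMem hy F).symm
  have hgc : Continuous g := by
    rw [continuous_iff_continuousAt]
    intro x
    by_cases hx : x ∈ G
    · exact (hgd x hx).continuousAt
    · have : g x = 0 := Set.indicator_of_notMem hx F
      rw [ContinuousAt, this]
      exact hg0 x hx
  set D : E → ℝ := G.indicator fun x => fderiv ℝ F x v with hD
  have hDi : Integrable D μ := (integrable_indicator_iff hG.measurableSet).2 hi'
  have hgi : Integrable g μ := (integrable_indicator_iff hG.measurableSet).2 hi
  have hint : ∀ ε : ℝ, Integrable (fun x => softCut ε (g x) * D x) μ := fun ε =>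
    hDi.bdd_mul ((continuous_softCut ε).comp hgc).aestronglyMeasurable (c := 1)
      (ae_of_all _ fun x => by
        rw [Real.norm_of_nonneg (softCut_nonneg _ _)]; exact softCut_le_one _ _)
  have hzero : ∀ ε : ℝ, 0 < ε → ∫ x, softCut ε (g x) * D x ∂μ = 0 := by
    intro ε hε
    -- The truncated function vanishes near each point outside `G`, so it is differentiable there.
    have hline : ∀ x,
        HasLineDerivAt ℝ (fun x => softTrunc ε (g x)) (softCut ε (g x) * D x) x v := by
      intro x
      by_cases hx : x ∈ G
      · have := ((hasDerivAt_softTrunc ε (g x)).comp_hasFDerivAt x (hgd x hx)).hasLineDerivAt v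
        simpa [hD, hx, Function.comp_def] using this
      · have h0 : (fun x => softTrunc ε (g x)) =ᶠ[𝓝 x] fun _ => 0 := by
          have := (hg0 x hx).abs
          rw [abs_zero] at this
          filter_upwards [this.eventually (gt_mem_nhds hε)] with y hy
          exact softTrunc_eq_zero hε hy.le
        have := ((hasFDerivAt_const (𝕜 := ℝ) (0 : ℝ) x).congr_of_eventuallyEq h0).hasLineDerivAt v
        simpa [hD, hx] using this
    have hti : Integrable (fun x => softTrunc ε (g x)) μ :=
      hgi.mono ((continuous_softTrunc ε).comp hgc).aestronglyMeasurable
        (ae_of_all _ fun x => by simpa using abs_softTrunc_le ε (g x))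
    have hone : ∀ x : E, HasLineDerivAt ℝ (fun _ : E => (1 : ℝ)) 0 x v := fun x => by
      simpa using (hasFDerivAt_const (𝕜 := ℝ) (1 : ℝ) x).hasLineDerivAt v
    have := integral_bilinear_hasLineDerivAt_right_eq_neg_left_of_integrable (μ := μ) (v := v)
      (f := fun _ : E => (1 : ℝ)) (f' := fun _ : E => (0 : ℝ)) (g := fun x => softTrunc ε (g x))
      (g' := fun x => softCut ε (g x) * D x) (B := ContinuousLinearMap.mul ℝ ℝ)
      (by simp) (by simpa using hint ε) (by simpa using hti)
      (fun x _ => hone x) (fun x _ => hline x)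
    simpa using this
  have hlim : Tendsto (fun n : ℕ => ∫ x, softCut (1 / ((n : ℝ) + 1)) (g x) * D x ∂μ) atTop
      (𝓝 (∫ x, D x ∂μ)) := by
    refine tendsto_integral_of_dominated_convergence (fun x => ‖D x‖)
      (fun n => (hint _).aestronglyMeasurable) hDi.norm (fun n => ae_of_all _ fun x => ?_) ?_
    · rw [norm_mul, Real.norm_of_nonneg (softCut_nonneg _ _)]
      exact mul_le_of_le_one_left (norm_nonneg _) (softCut_le_one _ _)
    · filter_upwards [ae_fderiv_apply_eq_zero_of_eq_zero (μ := μ) hgc.measurable hG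
        (fun x hx => (hgd x hx).differentiableAt) v] with x hx
      by_cases hx0 : g x = 0
      · have : D x = 0 := by
          by_cases hxG : x ∈ G
          · have := hx hxG hx0
            rw [(hgd x hxG).fderiv] at this
            simpa [hD, hxG] using this
          · simp [hD, hxG]
        simp [this]
      · refine tendsto_const_nhds.congr' ?_
        have h1 : Tendsto (fun n : ℕ => 2 * (1 / ((n : ℝ) + 1))) atTop (𝓝 0) := by
          simpa using tendsto_one_div_add_atTop_nhds_zero_nat.const_mul (2 : ℝ)
        filter_upwards [h1.eventually (gt_mem_nhds (abs_pos.2 hx0))] with n hn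
        rw [softCut_eq_one (by positivity) hn.le, one_mul]
  have h0 : ∫ x, D x ∂μ = 0 := by
    refine tendsto_nhds_unique hlim ?_
    exact tendsto_const_nhds.congr fun n => (hzero _ (by positivity)).symm
  rwa [hD, integral_indicator hG.measurableSet] at h0

end Divergence

/-! ### The weighted divergence identity -/

theorem jacTrace_eq_sum {p : ℕ} (s : Vec p → Vec p) (θ : Vec p) :
    jacTrace s θ = ∑ i, fderiv ℝ s θ (EuclideanSpace.single i 1) i := by
  rw [jacTrace, LinearMap.trace_eq_sum_inner _ (EuclideanSpace.basisFun (Fin p) ℝ)]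
  simp [EuclideanSpace.inner_single_left]

theorem abs_coord_le_norm {p : ℕ} (v : Vec p) (i : Fin p) : |v i| ≤ ‖v‖ := by
  simpa using PiLp.norm_apply_le v i

theorem abs_apply_single_le {p : ℕ} (A : Vec p →L[ℝ] Vec p) (i : Fin p) :
    |A (EuclideanSpace.single i 1) i| ≤ ‖A‖ :=
  (abs_coord_le_norm _ i).trans <| (A.le_opNorm _).trans <| by simp

theorem gradient_coord {p : ℕ} (f : Vec p → ℝ) (θ : Vec p) (i : Fin p) :
    gradient f θ i = fderiv ℝ f θ (EuclideanSpace.single i 1) := by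
  rw [← InnerProductSpace.toDual_symm_apply (𝕜 := ℝ), gradient, real_inner_comm,
    EuclideanSpace.inner_single_left]
  simp

/-- The divergence theorem for the field `w D`, written as `w (tr ∂D + ⟪D, ∇ log w⟫)`, on an open
set at whose boundary the field vanishes. -/
theorem setIntegral_weighted_divergence_eq_zero {p : ℕ} {G : Set (Vec p)} (hG : IsOpen G)
    {w : Vec p → ℝ} {D A : Vec p → Vec p} {T : Vec p → ℝ} (hwm : Measurable w) (hDm : Measurable D)
    (hw0 : ∀ θ ∈ G, 0 < w θ) (hwd : ∀ θ ∈ G, DifferentiableAt ℝ w θ)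
    (hDd : ∀ θ ∈ G, DifferentiableAt ℝ D θ)
    (hb : ∀ θ, θ ∉ G → Tendsto (fun t => w t • D t) (𝓝[G] θ) (𝓝 0))
    (hA : ∀ θ ∈ G, gradient (fun t => Real.log (w t)) θ = A θ)
    (hDi : IntegrableOn (fun θ => w θ * ‖D θ‖) G)
    (hT : ∀ θ ∈ G, ‖fderiv ℝ D θ‖ ≤ T θ) (hTi : IntegrableOn (fun θ => w θ * T θ) G)
    (hgi : IntegrableOn (fun θ => w θ * (‖D θ‖ * ‖A θ‖)) G) :
    ∫ θ in G, w θ * (jacTrace D θ + inner ℝ (D θ) (A θ)) = 0 := by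
  have hDm' : ∀ i, Measurable fun θ => D θ i := fun i => by fun_prop
  have hDid : ∀ i, ∀ θ ∈ G, HasFDerivAt (fun t => D t i)
      ((EuclideanSpace.proj i : Vec p →L[ℝ] ℝ).comp (fderiv ℝ D θ)) θ := fun i θ hθ =>
    (EuclideanSpace.proj i : Vec p →L[ℝ] ℝ).hasFDerivAt.comp θ (hDd θ hθ).hasFDerivAt
  have hF : ∀ i, ∀ θ ∈ G, HasFDerivAt (fun t => w t * D t i)
      (w θ • (EuclideanSpace.proj i : Vec p →L[ℝ] ℝ).comp (fderiv ℝ D θ) +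
        D θ i • fderiv ℝ w θ) θ := fun i θ hθ => (hwd θ hθ).hasFDerivAt.mul (hDid i θ hθ)
  have hgrad : ∀ i, ∀ θ ∈ G, fderiv ℝ w θ (EuclideanSpace.single i 1) =
      w θ * A θ i := by
    intro i θ hθ
    rw [← hA θ hθ, gradient_coord, fderiv.log (hwd θ hθ) (hw0 θ hθ).ne']
    simp [(hw0 θ hθ).ne']
  have hFi : ∀ i, ∀ θ ∈ G, fderiv ℝ (fun t => w t * D t i) θ (EuclideanSpace.single i 1) =
      w θ * (fderiv ℝ D θ (EuclideanSpace.single i 1) i +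
        D θ i * A θ i) := by
    intro i θ hθ
    rw [(hF i θ hθ).fderiv]
    simp [hgrad i θ hθ]
    ring
  have hint : ∀ i, IntegrableOn
      (fun θ => fderiv ℝ (fun t => w t * D t i) θ (EuclideanSpace.single i 1)) G := by
    intro i
    refine Integrable.mono (hTi.add hgi)
      (measurable_fderiv_apply_const ℝ _ _).aestronglyMeasurable ?_
    filter_upwards [ae_restrict_mem hG.measurableSet] with θ hθ
    rw [hFi i θ hθ, Real.norm_eq_abs, abs_mul, abs_of_pos (hw0 θ hθ)]
    simp only [Pi.add_apply]
    rw [← mul_add, Real.norm_eq_abs]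
    refine le_trans ?_ (le_abs_self _)
    refine mul_le_mul_of_nonneg_left ?_ (hw0 θ hθ).le
    refine (abs_add_le _ _).trans (add_le_add ((abs_apply_single_le _ i).trans (hT θ hθ)) ?_)
    rw [abs_mul]
    exact mul_le_mul (abs_coord_le_norm _ i) (abs_coord_le_norm _ i) (abs_nonneg _) (norm_nonneg _)
  have hzero : ∀ i,
      ∫ θ in G, fderiv ℝ (fun t => w t * D t i) θ (EuclideanSpace.single i 1) = 0 := by
    intro i
    refine setIntegral_fderiv_eq_zero hG (fun θ hθ => (hF i θ hθ).differentiableAt) ?_ ?_ _ (hint i)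
    · intro θ hθ
      have := ((EuclideanSpace.proj i : Vec p →L[ℝ] ℝ).continuous.tendsto 0).comp (hb θ hθ)
      simpa [Function.comp_def] using this
    · refine Integrable.mono hDi (hwm.mul (hDm' i)).aestronglyMeasurable (ae_of_all _ fun θ => ?_)
      rw [norm_mul, norm_mul, norm_norm]
      exact mul_le_mul_of_nonneg_left (abs_coord_le_norm _ i) (norm_nonneg _)
  have hsum := integral_finsetSum Finset.univ fun i _ => hint i
  rw [Finset.sum_congr rfl fun i _ => hzero i, Finset.sum_const_zero] at hsum
  rw [← hsum]
  refine setIntegral_congr_fun hG.measurableSet fun θ hθ => ?_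
  simp only [hFi _ θ hθ]
  rw [← Finset.mul_sum, Finset.sum_add_distrib, jacTrace_eq_sum, PiLp.inner_apply]
  congr 2
  exact Finset.sum_congr rfl fun i _ => by simp [mul_comm]

/-! ### A uniform law of large numbers -/

section Uniform

variable {Z T Ω₀ : Type*} [MeasurableSpace Z] [MeasurableSpace Ω₀]
  {P : Measure Ω₀} {data : ℕ → Ω₀ → Z} {law : Measure Z}

/-- The strong law of large numbers for an integrable function of i.i.d. data. -/
theorem ae_tendsto_average [IsProbabilityMeasure P] (hm : ∀ n, Measurable (data n))
    (hind : iIndepFun data P) (hlaw : ∀ n, P.map (data n) = law) {g : Z → ℝ}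
    (hg : Integrable g law) :
    ∀ᵐ ω ∂P, Tendsto (fun N : ℕ => (1 / (N : ℝ)) * ∑ n ∈ Finset.range N, g (data n ω)) atTop
      (𝓝 (∫ z, g z ∂law)) := by
  have hgm : ∀ n, AEMeasurable g (P.map (data n)) := fun n => by
    rw [hlaw n]; exact hg.aestronglyMeasurable.aemeasurable
  have h := strong_law_ae_real (μ := P) (fun n ω => g (data n ω))
    ((hlaw 0 ▸ hg).comp_measurable (hm 0))
    (fun i j hij => (hind.indepFun hij).comp₀ (hm i).aemeasurable (hm j).aemeasurable
      (hgm i) (hgm j))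
    (fun i => IdentDistrib.comp_of_aemeasurable
      ⟨(hm i).aemeasurable, (hm 0).aemeasurable, by rw [hlaw i, hlaw 0]⟩ (hgm i))
  have he : ∫ ω, g (data 0 ω) ∂P = ∫ z, g z ∂law := by
    rw [← hlaw 0, integral_map (hm 0).aemeasurable (hlaw 0 ▸ hg.aestronglyMeasurable)]
  filter_upwards [h] with ω hω
  rw [← he]
  refine hω.congr fun N => ?_
  rw [div_eq_mul_one_div, mul_comm]

/-- A uniform law of large numbers: the averages of a family of integrable functions that is
Lipschitz in a parameter `t` of a compact set `S`, with an integrable Lipschitz constant, converge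
almost surely to their expectations, uniformly over `S`. -/
theorem ae_eventually_forall_abs_average_sub_le [PseudoMetricSpace T] [IsProbabilityMeasure P]
    (hm : ∀ n, Measurable (data n)) (hind : iIndepFun data P)
    (hlaw : ∀ n, P.map (data n) = law) {S : Set T} (hS : IsCompact S) {h : T → Z → ℝ}
    (hint : ∀ t ∈ S, Integrable (h t) law) {κ : Z → ℝ} (hκ : Integrable κ law)
    (hlip : ∀ᵐ z ∂law, ∀ t₁ ∈ S, ∀ t₂ ∈ S, |h t₁ z - h t₂ z| ≤ κ z * dist t₁ t₂) :
    ∀ᵐ ω ∂P, ∀ ε > 0, ∀ᶠ N : ℕ in atTop, ∀ t ∈ S,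
      |(1 / (N : ℝ)) * ∑ n ∈ Finset.range N, h t (data n ω) - ∫ z, h t z ∂law| ≤ ε := by
  obtain ⟨c, hcS, hcc, hc⟩ := hS.isSeparable.exists_countable_dense_subset
  have h1 : ∀ᵐ ω ∂P, ∀ t ∈ c, Tendsto
      (fun N : ℕ => (1 / (N : ℝ)) * ∑ n ∈ Finset.range N, h t (data n ω)) atTop
      (𝓝 (∫ z, h t z ∂law)) :=
    (ae_ball_iff hcc).2 fun t ht => ae_tendsto_average hm hind hlaw (hint t (hcS ht))
  have h2 := ae_tendsto_average hm hind hlaw hκ.abs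
  have h3 : ∀ᵐ ω ∂P, ∀ n, ∀ t₁ ∈ S, ∀ t₂ ∈ S,
      |h t₁ (data n ω) - h t₂ (data n ω)| ≤ κ (data n ω) * dist t₁ t₂ :=
    ae_all_iff.2 fun n => ae_of_ae_map (hm n).aemeasurable (by rw [hlaw n]; exact hlip)
  filter_upwards [h1, h2, h3] with ω h1 h2 h3 ε hε
  set C : ℝ := (∫ z, |κ z| ∂law) + 1 with hC
  have hI0 : 0 ≤ ∫ z, |κ z| ∂law := integral_nonneg fun z => abs_nonneg _
  have hC0 : 0 < C := by linarith
  set δ : ℝ := ε / (4 * C) with hδ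
  have hδ0 : 0 < δ := by positivity
  have hCδ : C * δ = ε / 4 := by rw [hδ]; field_simp
  -- By compactness it suffices to control finitely many points of a countable dense subset.
  obtain ⟨b, hbc, hbf, hb⟩ := hS.elim_finite_subcover_image (b := c)
    (c := fun t => Metric.ball t δ) (fun _ _ => Metric.isOpen_ball) (fun t ht => by
      obtain ⟨y, hy, hyt⟩ := Metric.mem_closure_iff.1 (hc ht) δ hδ0
      exact Set.mem_biUnion hy hyt)
  have h4 : ∀ᶠ N : ℕ in atTop, ∀ t ∈ b,
      |(1 / (N : ℝ)) * ∑ n ∈ Finset.range N, h t (data n ω) - ∫ z, h t z ∂law| < ε / 2 := by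
    refine (hbf.eventually_all).2 fun t ht => ?_
    have := (h1 t (hbc ht)).sub_const (∫ z, h t z ∂law) |>.abs
    rw [sub_self, abs_zero] at this
    exact this.eventually (gt_mem_nhds (by positivity))
  filter_upwards [h4, h2.eventually (gt_mem_nhds (show ∫ z, |κ z| ∂law < C by linarith))]
    with N h4 h5 t ht
  obtain ⟨y, hy, hty⟩ := Set.mem_iUnion₂.1 (hb ht)
  have hyS := hcS (hbc hy)
  have hd : dist t y ≤ δ := (Metric.mem_ball.1 hty).le
  have e1 : |(1 / (N : ℝ)) * ∑ n ∈ Finset.range N, h t (data n ω) -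
      (1 / (N : ℝ)) * ∑ n ∈ Finset.range N, h y (data n ω)| ≤ C * δ := by
    rw [← mul_sub, ← Finset.sum_sub_distrib, abs_mul, abs_of_nonneg (by positivity)]
    calc _ ≤ (1 / (N : ℝ)) * ∑ n ∈ Finset.range N, |κ (data n ω)| * δ := by
          refine mul_le_mul_of_nonneg_left ?_ (by positivity)
          refine (Finset.abs_sum_le_sum_abs _ _).trans (Finset.sum_le_sum fun n _ => ?_)
          exact (h3 n t ht y hyS).trans (mul_le_mul (le_abs_self _) hd dist_nonneg (abs_nonneg _))
      _ = ((1 / (N : ℝ)) * ∑ n ∈ Finset.range N, |κ (data n ω)|) * δ := by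
          rw [← Finset.sum_mul, mul_assoc]
      _ ≤ C * δ := mul_le_mul_of_nonneg_right h5.le hδ0.le
  have e2 : |∫ z, h t z ∂law - ∫ z, h y z ∂law| ≤ C * δ := by
    rw [← integral_sub (hint t ht) (hint y hyS)]
    calc _ ≤ ∫ z, |h t z - h y z| ∂law := abs_integral_le_integral_abs
      _ ≤ ∫ z, |κ z| * δ ∂law := by
          refine integral_mono_ae ((hint t ht).sub (hint y hyS)).abs (hκ.abs.mul_const δ) ?_
          filter_upwards [hlip] with z hz
          exact (hz t ht y hyS).trans (mul_le_mul (le_abs_self _) hd dist_nonneg (abs_nonneg _))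
      _ = (∫ z, |κ z| ∂law) * δ := integral_mul_const _ _
      _ ≤ C * δ := mul_le_mul_of_nonneg_right (by linarith) hδ0.le
  have e3 := h4 y hy
  rw [hCδ] at e1 e2
  rw [abs_le] at e1 e2 ⊢
  rw [abs_lt] at e3
  constructor <;> linarith [e1.1, e1.2, e2.1, e2.2, e3.1, e3.2]

end Uniform

/-! ### Supports and marginals of the model -/

theorem lintegral_pi_fin_prod {K : ℕ} {X : Type*} [MeasurableSpace X]
    {ν : Measure X} [SigmaFinite ν] (f : Fin K → X → ENNReal) (hf : ∀ i, Measurable (f i)) :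
    ∫⁻ y : Fin K → X, ∏ i, f i (y i) ∂(Measure.pi fun _ => ν) = ∏ i, ∫⁻ x, f i x ∂ν := by
  induction K with
  | zero => simp
  | succ n ih =>
    rw [← ((measurePreserving_piFinSuccAbove (fun _ : Fin (n + 1) => ν) 0).symm).lintegral_comp_emb
      (MeasurableEquiv.measurableEmbedding _)]
    simp_rw [MeasurableEquiv.piFinSuccAbove_symm_apply, Fin.insertNthEquiv, Fin.prod_univ_succ,
      Fin.insertNth_zero, Equiv.coe_fn_mk, Fin.cons_succ, cast_eq, Fin.cons_zero]
    rw [← ih (fun i => f i.succ) fun i => hf _]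
    have hm : Measurable fun y : Fin n → X => ∏ i, f i.succ (y i) :=
      Finset.measurable_fun_prod _ fun i _ => (hf _).comp (measurable_pi_apply i)
    exact lintegral_prod_mul (hf 0).aemeasurable hm.aemeasurable

/-- Under a product of copies of a probability density `f`, the `j`-th coordinate has
density `f`. -/
theorem lintegral_pi_fin_mul_prod {K : ℕ} {X : Type*} [MeasurableSpace X] {ν : Measure X}
    [SigmaFinite ν] {f g : X → ENNReal} (hf : Measurable f) (hg : Measurable g)
    (h1 : ∫⁻ x, f x ∂ν = 1) (j : Fin K) :
    ∫⁻ y : Fin K → X, g (y j) * ∏ i, f (y i) ∂(Measure.pi fun _ => ν) = ∫⁻ x, g x * f x ∂ν := by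
  have h := lintegral_pi_fin_prod (ν := ν) (fun i x => (if i = j then g x else 1) * f x)
    fun i => by split_ifs <;> fun_prop
  simp only [Finset.prod_mul_distrib, Finset.prod_ite_eq', Finset.mem_univ, if_true] at h
  rw [h, Finset.prod_eq_single j]
  · simp
  · intro i _ hij; simp [hij, h1]
  · simp

theorem withDensity_eq_restrict_withDensity {X : Type*} [MeasurableSpace X] {μ : Measure X}
    {f : X → ENNReal} {s : Set X} (hs : MeasurableSet s) (h : ∀ᵐ x ∂μ, x ∈ s ∨ f x = 0) :
    μ.withDensity f = (μ.restrict s).withDensity f := by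
  rw [← withDensity_indicator hs]
  refine withDensity_congr_ae ?_
  filter_upwards [h] with x hx
  by_cases hxs : x ∈ s
  · simp [hxs]
  · simp [hxs, hx.resolve_left hxs]

/-- The points of the boundary are themselves approached within `Θ`, so a field that vanishes at the
boundary can be nonzero there only on a countable set. -/
theorem VanishesAtBoundary.countable_ne_zero {p : ℕ} {Θ : Set (Vec p)} {g : Vec p → Vec p}
    (hΘ : IsClosed Θ) (h : VanishesAtBoundary Θ g) : {θ | θ ∈ frontier Θ ∧ g θ ≠ 0}.Countable := by
  have hsub : {θ | θ ∈ frontier Θ ∧ g θ ≠ 0} ⊆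
      ⋃ n : ℕ, {θ | θ ∈ frontier Θ ∧ 1 / ((n : ℝ) + 1) < ‖g θ‖} := by
    rintro θ ⟨hθ, hg⟩
    obtain ⟨n, hn⟩ := exists_nat_one_div_lt (norm_pos_iff.2 hg)
    exact Set.mem_iUnion.2 ⟨n, hθ, hn⟩
  refine (Set.countable_iUnion fun n => countable_of_isolated ?_).mono hsub
  rintro b ⟨hb, -⟩
  have h1 := (h.1 b hb).norm
  rw [norm_zero] at h1
  have h2 := h1.eventually (gt_mem_nhds (show (0 : ℝ) < 1 / ((n : ℝ) + 1) by positivity))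
  rw [eventually_nhdsWithin_iff] at h2 ⊢
  filter_upwards [h2] with y hy hyb hy2
  exact (hy ⟨hΘ.frontier_subset hy2.1, hyb⟩).not_gt hy2.2

theorem VanishesAtBoundary.tendsto_nhdsWithin_interior {p : ℕ} {Θ : Set (Vec p)}
    {g : Vec p → Vec p} (hΘ : IsClosed Θ) (h : VanishesAtBoundary Θ g) {θ : Vec p}
    (hθ : θ ∉ interior Θ) : Tendsto g (𝓝[interior Θ] θ) (𝓝 0) := by
  by_cases hm : θ ∈ Θ
  · refine (h.1 θ ?_).mono_left (nhdsWithin_mono _ ?_)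
    · rw [hΘ.frontier_eq]; exact ⟨hm, hθ⟩
    · exact fun y hy => ⟨interior_subset hy, fun hyθ => hθ (hyθ ▸ hy)⟩
  · have : θ ∉ closure (interior Θ) := fun hc =>
      hm (hΘ.closure_subset (closure_mono interior_subset hc))
    rw [notMem_closure_iff_nhdsWithin_eq_bot.1 this]
    exact tendsto_bot

namespace BayesModel

variable {p m : ℕ} (M : BayesModel p m)

theorem isClosed_paramSet : IsClosed M.paramSet := M.paramSet_perfect.closed

theorem measurableSet_interior : MeasurableSet (interior M.paramSet) :=
  isOpen_interior.measurableSet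

@[fun_prop]
theorem measurable_joint : Measurable fun z : Vec p × Vec m => M.joint z.2 z.1 :=
  M.lik_measurable.mul (M.prior_measurable.comp measurable_fst)

theorem measurable_lik_left (θ : Vec p) : Measurable fun x => M.lik x θ :=
  M.lik_measurable.comp (measurable_const.prodMk measurable_id)

theorem joint_nonneg (x : Vec m) (θ : Vec p) : 0 ≤ M.joint x θ :=
  mul_nonneg (M.lik_nonneg x θ) (M.prior_nonneg θ)

theorem ofReal_joint (x : Vec m) (θ : Vec p) : ENNReal.ofReal (M.joint x θ) =
    ENNReal.ofReal (M.lik x θ) * ENNReal.ofReal (M.prior θ) :=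
  ENNReal.ofReal_mul (M.lik_nonneg x θ)

instance isProbabilityMeasure_priorLaw : IsProbabilityMeasure M.priorLaw := ⟨by
  rw [priorLaw, withDensity_apply _ MeasurableSet.univ, Measure.restrict_univ, M.prior_lintegral]⟩

variable {M}

/-- Since the likelihood integrates to one wherever the prior is positive, the joint density can
only vanish for almost all observations if the prior does. -/
theorem prior_eq_zero_of_joint_ae_eq_zero {θ : Vec p} (hθ : θ ∈ M.paramSet)
    (h : ∀ᵐ x ∂M.ref.restrict M.obsSet, M.joint x θ = 0) : M.prior θ = 0 := by
  by_contra hne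
  have hpos : 0 < M.prior θ := lt_of_le_of_ne (M.prior_nonneg θ) (Ne.symm hne)
  have h1 := M.lik_lintegral θ hθ hpos
  rw [lintegral_congr_ae (g := fun _ => 0)] at h1
  · simp at h1
  · filter_upwards [h] with x hx
    simp [(mul_eq_zero.1 hx).resolve_right hne]

/-- The boundary of the parameter set, even if it has positive volume, carries no prior mass. -/
theorem ae_mem_interior_or_prior_eq_zero (h : M.BCRBRegular) :
    ∀ᵐ θ ∂volume.restrict M.paramSet, θ ∈ interior M.paramSet ∨ M.prior θ = 0 := by
  -- The boundary condition says nothing about `θ = 0`, a null set unless `p = 0`; in dimension zero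
  -- the boundary is empty.
  have h1 : ∀ x ∈ M.obsSet, ∀ᵐ θ ∂volume.restrict M.paramSet,
      θ ∈ interior M.paramSet ∨ M.joint x θ = 0 := by
    intro x hx
    rcases Nat.eq_zero_or_pos p with rfl | hp
    · have : interior M.paramSet = M.paramSet := by
        rw [interior_eq_iff_isOpen]; exact isOpen_discrete _
      rw [this]
      filter_upwards [ae_restrict_mem M.isClosed_paramSet.measurableSet] with θ hθ
      exact Or.inl hθ
    · have : Nonempty (Fin p) := ⟨⟨0, hp⟩⟩
      have hc := ((h.boundary x hx).countable_ne_zero M.isClosed_paramSet).union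
        (Set.countable_singleton (0 : Vec p))
      filter_upwards [ae_restrict_mem M.isClosed_paramSet.measurableSet,
        ae_restrict_of_ae (hc.ae_notMem volume)] with θ hθ hn
      by_contra! hcon
      refine hn ?_
      by_cases h0 : θ = 0
      · exact Or.inr h0
      · exact Or.inl ⟨by rw [M.isClosed_paramSet.frontier_eq]; exact ⟨hθ, hcon.1⟩,
          smul_ne_zero hcon.2 h0⟩
  have hm : MeasurableSet {z : Vec m × Vec p | z.2 ∈ interior M.paramSet ∨ M.joint z.1 z.2 = 0} :=
    (measurable_snd M.measurableSet_interior).union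
      ((M.measurable_joint.comp measurable_swap) (measurableSet_singleton 0))
  have h2 : ∀ᵐ x ∂M.ref.restrict M.obsSet, ∀ᵐ θ ∂volume.restrict M.paramSet,
      θ ∈ interior M.paramSet ∨ M.joint x θ = 0 := by
    filter_upwards [ae_restrict_mem M.obsSet_measurable] with x hx using h1 x hx
  rw [Measure.ae_ae_comm hm] at h2
  filter_upwards [h2, ae_restrict_mem M.isClosed_paramSet.measurableSet] with θ hθ hmem
  by_cases hi : θ ∈ interior M.paramSet
  · exact Or.inl hi
  · exact Or.inr (prior_eq_zero_of_joint_ae_eq_zero hmem (hθ.mono fun x hx => hx.resolve_left hi))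

theorem priorLaw_eq_restrict_interior (h : M.BCRBRegular) :
    M.priorLaw = (volume.restrict (interior M.paramSet)).withDensity
      fun θ => ENNReal.ofReal (M.prior θ) := by
  rw [priorLaw, withDensity_eq_restrict_withDensity M.measurableSet_interior,
    Measure.restrict_restrict_of_subset interior_subset]
  filter_upwards [ae_mem_interior_or_prior_eq_zero h] with θ hθ
  exact hθ.imp_right fun h0 => by simp [h0]

theorem jointLaw_eq_restrict_interior (h : M.BCRBRegular) :
    M.jointLaw = ((volume.restrict (interior M.paramSet)).prod
      (M.ref.restrict M.obsSet)).withDensity fun z => ENNReal.ofReal (M.joint z.2 z.1) := by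
  rw [jointLaw, withDensity_eq_restrict_withDensity
    (M.measurableSet_interior.prod MeasurableSet.univ)]
  · rw [← Measure.prod_restrict, Measure.restrict_univ,
      Measure.restrict_restrict_of_subset interior_subset]
  · have := (Measure.quasiMeasurePreserving_fst (μ := volume.restrict M.paramSet)
      (ν := M.ref.restrict M.obsSet)).ae (ae_mem_interior_or_prior_eq_zero h)
    filter_upwards [this] with z hz
    exact hz.imp (fun h1 => ⟨h1, trivial⟩) fun h0 => by simp [joint, h0]

/-- The prior is positive on the interior of the parameter set, and the observations split into a
set `U` on which the likelihood is positive at all interior parameters and a set on which the joint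
density vanishes there. If the prior had a zero in the interior, the common support would be empty
and no mass would be left. -/
theorem exists_common_support (h : M.BCRBRegular) : ∃ U ⊆ M.obsSet,
    (∀ θ ∈ interior M.paramSet, 0 < M.prior θ) ∧
    (∀ x ∈ U, ∀ θ ∈ interior M.paramSet, 0 < M.lik x θ) ∧
    ∀ x ∈ M.obsSet, x ∉ U → ∀ θ ∈ interior M.paramSet, M.joint x θ = 0 := by
  obtain ⟨U, hU, hc⟩ := h.common_support
  have hU' : ∀ θ ∈ interior M.paramSet, ∀ x, x ∈ U → 0 < M.joint x θ := fun θ hθ x hx => by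
    rw [← hc θ hθ] at hx; exact hx.2
  have hn : ∀ x ∈ M.obsSet, x ∉ U → ∀ θ ∈ interior M.paramSet, M.joint x θ = 0 := by
    intro x hx hxU θ hθ
    rw [← hc θ hθ] at hxU
    by_contra hne
    exact hxU ⟨hx, lt_of_le_of_ne (M.joint_nonneg x θ) (Ne.symm hne)⟩
  have hne : U.Nonempty := by
    by_contra hemp
    rw [Set.not_nonempty_iff_eq_empty] at hemp
    have h0 : ∀ θ ∈ interior M.paramSet, M.prior θ = 0 := fun θ hθ =>
      prior_eq_zero_of_joint_ae_eq_zero (interior_subset hθ) <| by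
        filter_upwards [ae_restrict_mem M.obsSet_measurable] with x hx
        exact hn x hx (by simp [hemp]) θ hθ
    have h1 := M.prior_lintegral
    rw [lintegral_congr_ae (g := fun _ => 0)] at h1
    · simp at h1
    · filter_upwards [ae_mem_interior_or_prior_eq_zero h] with θ hθ
      simp [hθ.elim (h0 θ) id]
  obtain ⟨x₀, hx₀⟩ := hne
  exact ⟨U, hU, fun θ hθ => pos_of_mul_pos_right (hU' θ hθ x₀ hx₀) (M.lik_nonneg _ _),
    fun x hx θ hθ => pos_of_mul_pos_left (hU' θ hθ x hx) (M.prior_nonneg _), hn⟩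

variable (M)

theorem measurePreserving_fst_jointLaw : MeasurePreserving Prod.fst M.jointLaw M.priorLaw := by
  refine ⟨measurable_fst, Measure.ext fun A hA => ?_⟩
  rw [Measure.map_apply measurable_fst hA, jointLaw, withDensity_apply _ (measurable_fst hA),
    priorLaw, withDensity_apply _ hA, ← lintegral_indicator (measurable_fst hA),
    ← lintegral_indicator hA, lintegral_prod]
  · refine setLIntegral_congr_fun M.isClosed_paramSet.measurableSet fun θ hθ => ?_
    by_cases hA' : θ ∈ A
    · simp only [Set.indicator, Set.mem_preimage, hA', if_true, ofReal_joint]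
      rcases (M.prior_nonneg θ).eq_or_lt with h0 | h0
      · simp [← h0]
      · rw [lintegral_mul_const _ (M.measurable_lik_left θ).ennreal_ofReal,
          M.lik_lintegral θ hθ h0, one_mul]
    · simp [Set.indicator, hA']
  · exact (M.measurable_joint.ennreal_ofReal.indicator (measurable_fst hA)).aemeasurable

instance isProbabilityMeasure_jointLaw : IsProbabilityMeasure M.jointLaw := ⟨by
  rw [← Set.preimage_univ (f := Prod.fst),
    M.measurePreserving_fst_jointLaw.measure_preimage MeasurableSet.univ.nullMeasurableSet,
    measure_univ]⟩

theorem measurePreserving_recordLaw {K : ℕ} (j : Fin K) :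
    MeasurePreserving (fun z : Vec p × (Fin K → Vec m) => (z.1, z.2 j)) (M.recordLaw K)
      M.jointLaw := by
  have hm : Measurable fun z : Vec p × (Fin K → Vec m) => (z.1, z.2 j) := by fun_prop
  have hlik : ∀ i : Fin K, Measurable fun z : Vec p × (Fin K → Vec m) => M.lik (z.2 i) z.1 :=
    fun i => M.lik_measurable.comp
      (measurable_fst.prodMk ((measurable_pi_apply i).comp measurable_snd))
  have hdens : Measurable fun z : Vec p × (Fin K → Vec m) =>
      ENNReal.ofReal (M.prior z.1 * ∏ i, M.lik (z.2 i) z.1) :=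
    ((M.prior_measurable.comp measurable_fst).mul
      (Finset.measurable_fun_prod _ fun i _ => hlik i)).ennreal_ofReal
  refine ⟨hm, Measure.ext fun A hA => ?_⟩
  rw [Measure.map_apply hm hA, recordLaw, withDensity_apply _ (hm hA), jointLaw,
    withDensity_apply _ hA, ← lintegral_indicator (hm hA), ← lintegral_indicator hA,
    lintegral_prod _ (hdens.indicator (hm hA)).aemeasurable,
    lintegral_prod _ (M.measurable_joint.ennreal_ofReal.indicator hA).aemeasurable]
  refine setLIntegral_congr_fun M.isClosed_paramSet.measurableSet fun θ hθ => ?_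
  rcases (M.prior_nonneg θ).eq_or_lt with h0 | h0
  · simp [Set.indicator, ← h0, joint]
  set g : Vec m → ENNReal := fun x => A.indicator (fun _ => ENNReal.ofReal (M.prior θ)) (θ, x)
    with hg
  have hgm : Measurable g := (measurable_const.indicator hA).comp measurable_prodMk_left
  have := lintegral_pi_fin_mul_prod (M.measurable_lik_left θ).ennreal_ofReal hgm
    (M.lik_lintegral θ hθ h0) j
  convert this using 1
  · refine lintegral_congr fun y => ?_
    by_cases hy : (θ, y j) ∈ A
    · simp only [hg, Set.indicator, Set.mem_preimage, hy, if_true]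
      rw [ENNReal.ofReal_mul (M.prior_nonneg θ),
        ENNReal.ofReal_prod_of_nonneg fun i _ => M.lik_nonneg _ _]
    · simp [hg, Set.indicator, hy]
  · refine lintegral_congr fun x => ?_
    by_cases hx : (θ, x) ∈ A
    · simp only [hg, Set.indicator, hx, if_true, ofReal_joint, mul_comm]
    · simp [hg, Set.indicator, hx]

end BayesModel

/-! ### Integration by parts for the prior score -/

theorem jacTrace_sub_eq_sum {p : ℕ} (s₁ s₂ : Vec p → Vec p) (θ : Vec p) :
    jacTrace s₁ θ - jacTrace s₂ θ =
      ∑ i, (fderiv ℝ s₁ θ - fderiv ℝ s₂ θ) (EuclideanSpace.single i 1) i := by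
  simp [jacTrace_eq_sum, Finset.sum_sub_distrib]

theorem abs_jacTrace_sub_le {p : ℕ} (s₁ s₂ : Vec p → Vec p) (θ : Vec p) :
    |jacTrace s₁ θ - jacTrace s₂ θ| ≤ p * ‖fderiv ℝ s₁ θ - fderiv ℝ s₂ θ‖ := by
  rw [jacTrace_sub_eq_sum]
  refine (Finset.abs_sum_le_sum_abs _ _).trans ?_
  refine (Finset.sum_le_sum fun i _ => abs_apply_single_le _ i).trans ?_
  simp

theorem abs_apply_le_frobNorm {p : ℕ} (A : Matrix (Fin p) (Fin p) ℝ) (i j : Fin p) :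
    |A i j| ≤ frobNorm A := by
  refine Real.abs_le_sqrt ?_
  refine le_trans ?_ (Finset.single_le_sum (f := fun i => ∑ j, A i j ^ 2)
    (fun i _ => Finset.sum_nonneg fun j _ => sq_nonneg _) (Finset.mem_univ i))
  exact Finset.single_le_sum (f := fun j => A i j ^ 2) (fun j _ => sq_nonneg _) (Finset.mem_univ j)

theorem abs_normSq_sub_le {p : ℕ} (u v : Vec p) :
    |‖u‖ ^ 2 - ‖v‖ ^ 2| ≤ p * frobNorm (outer u - outer v) := by
  rw [EuclideanSpace.real_norm_sq_eq, EuclideanSpace.real_norm_sq_eq, ← Finset.sum_sub_distrib]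
  refine (Finset.abs_sum_le_sum_abs _ _).trans ?_
  have : ∀ i ∈ Finset.univ, |u i ^ 2 - v i ^ 2| ≤ frobNorm (outer u - outer v) := fun i _ => by
    refine le_trans (le_of_eq ?_) (abs_apply_le_frobNorm _ i i)
    simp [outer, sq]
  refine (Finset.sum_le_sum this).trans ?_
  simp

theorem differentiableAt_of_log {p : ℕ} {w : Vec p → ℝ} {G : Set (Vec p)} (hG : IsOpen G)
    (hw : ∀ θ ∈ G, 0 < w θ) {θ : Vec p} (hθ : θ ∈ G)
    (h : DifferentiableAt ℝ (fun t => Real.log (w t)) θ) : DifferentiableAt ℝ w θ := by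
  refine h.exp.congr_of_eventuallyEq ?_
  filter_upwards [hG.mem_nhds hθ] with t ht
  exact (Real.exp_log (hw t ht)).symm

theorem measurable_jacTrace {p : ℕ} (s : Vec p → Vec p) : Measurable (jacTrace s) := by
  simp_rw [funext (jacTrace_eq_sum s)]
  refine Finset.measurable_fun_sum _ fun i _ => ?_
  have := measurable_fderiv_apply_const ℝ s (EuclideanSpace.single i (1 : ℝ))
  fun_prop

/-- Measurability of the trace of a partial Jacobian jointly in the variable and the parameter, as
an almost everywhere limit of difference quotients; continuity in the parameter is not needed. -/
theorem aestronglyMeasurable_jacTrace_param {p : ℕ} {X : Type*} [MeasurableSpace X]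
    {μ : Measure (Vec p × X)} {s : X → Vec p → Vec p}
    (hs : Measurable fun z : Vec p × X => s z.2 z.1)
    (hd : ∀ᵐ z ∂μ, DifferentiableAt ℝ (s z.2) z.1) :
    AEStronglyMeasurable (fun z => jacTrace (s z.2) z.1) μ := by
  have hm : ∀ n : ℕ, Measurable fun z : Vec p × X => ∑ i : Fin p, (((n : ℝ) + 1) •
      (s z.2 (z.1 + ((n : ℝ) + 1)⁻¹ • EuclideanSpace.single i (1 : ℝ)) - s z.2 z.1)) i := by
    intro n
    refine Finset.measurable_fun_sum _ fun i _ => ?_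
    have h1 : Measurable fun z : Vec p × X =>
        s z.2 (z.1 + ((n : ℝ) + 1)⁻¹ • EuclideanSpace.single i (1 : ℝ)) :=
      hs.comp ((measurable_fst.add_const _).prodMk measurable_snd)
    exact (EuclideanSpace.proj i : Vec p →L[ℝ] ℝ).measurable.comp
      ((h1.sub hs).const_smul ((n : ℝ) + 1))
  refine aestronglyMeasurable_of_tendsto_ae atTop (fun n => (hm n).aestronglyMeasurable) ?_
  filter_upwards [hd] with z hz
  rw [jacTrace_eq_sum]
  refine tendsto_finsetSum _ fun i _ => ?_
  have := hz.hasFDerivAt.lim (EuclideanSpace.single i (1 : ℝ)) (c := fun n : ℕ => (n : ℝ) + 1)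
    (l := atTop) (by
      refine tendsto_norm_atTop_atTop.comp ?_
      exact tendsto_natCast_atTop_atTop.atTop_add tendsto_const_nhds)
  exact ((EuclideanSpace.proj i : Vec p →L[ℝ] ℝ).continuous.tendsto _).comp this

namespace BayesModel

variable {p m : ℕ} {M : BayesModel p m}

theorem integrable_priorLaw_iff (h : M.BCRBRegular) {f : Vec p → ℝ} :
    Integrable f M.priorLaw ↔ IntegrableOn (fun θ => M.prior θ * f θ) (interior M.paramSet) := by
  rw [priorLaw_eq_restrict_interior h, integrable_withDensity_iff_integrable_smul'
    M.prior_measurable.ennreal_ofReal (ae_of_all _ fun _ => ENNReal.ofReal_lt_top)]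
  simp only [ENNReal.toReal_ofReal (M.prior_nonneg _), smul_eq_mul, IntegrableOn]

theorem integral_priorLaw (h : M.BCRBRegular) (f : Vec p → ℝ) :
    ∫ θ, f θ ∂M.priorLaw = ∫ θ in interior M.paramSet, M.prior θ * f θ := by
  rw [priorLaw_eq_restrict_interior h, integral_withDensity_eq_integral_toReal_smul
    M.prior_measurable.ennreal_ofReal (ae_of_all _ fun _ => ENNReal.ofReal_lt_top)]
  simp only [ENNReal.toReal_ofReal (M.prior_nonneg _), smul_eq_mul]

theorem integrable_jointLaw_iff (h : M.BCRBRegular) {f : Vec p × Vec m → ℝ} :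
    Integrable f M.jointLaw ↔ Integrable (fun z => M.joint z.2 z.1 * f z)
      ((volume.restrict (interior M.paramSet)).prod (M.ref.restrict M.obsSet)) := by
  rw [jointLaw_eq_restrict_interior h, integrable_withDensity_iff_integrable_smul'
    M.measurable_joint.ennreal_ofReal (ae_of_all _ fun _ => ENNReal.ofReal_lt_top)]
  simp only [ENNReal.toReal_ofReal (M.joint_nonneg _ _), smul_eq_mul]

theorem ae_integrableOn_of_integrable_jointLaw (h : M.BCRBRegular) {f : Vec p × Vec m → ℝ}
    (hf : Integrable f M.jointLaw) : ∀ᵐ x ∂M.ref.restrict M.obsSet,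
      IntegrableOn (fun θ => M.joint x θ * f (θ, x)) (interior M.paramSet) :=
  ((integrable_jointLaw_iff h).1 hf).prod_left_ae

theorem integral_jointLaw (h : M.BCRBRegular) {f : Vec p × Vec m → ℝ}
    (hf : Integrable f M.jointLaw) : ∫ z, f z ∂M.jointLaw =
      ∫ x in M.obsSet, ∫ θ in interior M.paramSet, M.joint x θ * f (θ, x) ∂volume ∂M.ref := by
  rw [← integral_prod_symm _ ((integrable_jointLaw_iff h).1 hf), jointLaw_eq_restrict_interior h,
    integral_withDensity_eq_integral_toReal_smul
    M.measurable_joint.ennreal_ofReal (ae_of_all _ fun _ => ENNReal.ofReal_lt_top)]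
  simp only [ENNReal.toReal_ofReal (M.joint_nonneg _ _), smul_eq_mul]

theorem ae_priorLaw_mem_interior (h : M.BCRBRegular) :
    ∀ᵐ θ ∂M.priorLaw, θ ∈ interior M.paramSet := by
  rw [priorLaw_eq_restrict_interior h]
  exact (withDensity_absolutelyContinuous _ _).ae_le (ae_restrict_mem M.measurableSet_interior)

theorem ae_jointLaw_mem (h : M.BCRBRegular) :
    ∀ᵐ z ∂M.jointLaw, z.1 ∈ interior M.paramSet ∧ z.2 ∈ M.obsSet ∧ 0 < M.joint z.2 z.1 := by
  have h1 : ∀ᵐ z ∂M.jointLaw, z ∈ interior M.paramSet ×ˢ M.obsSet := by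
    rw [jointLaw_eq_restrict_interior h, Measure.prod_restrict]
    exact (withDensity_absolutelyContinuous _ _).ae_le
      (ae_restrict_mem (M.measurableSet_interior.prod M.obsSet_measurable))
  have h2 : ∀ᵐ z ∂M.jointLaw, 0 < M.joint z.2 z.1 := by
    rw [jointLaw, ae_withDensity_iff M.measurable_joint.ennreal_ofReal]
    exact ae_of_all _ fun z hz => ENNReal.ofReal_pos.1 (pos_iff_ne_zero.2 hz)
  filter_upwards [h1, h2] with z h1 h2 using ⟨h1.1, h1.2, h2⟩

section Prior

variable {q : ℕ} {S : Set (Vec q)} {sP : Vec q → Vec p → Vec p}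

theorem memLp_priorModel (hreg : M.PriorScoreRegular S sP) {Ω : Vec q} (hΩ : Ω ∈ S) :
    MemLp (sP Ω) 2 M.priorLaw :=
  (memLp_two_iff_integrable_sq_norm
    (hreg.model_measurable Ω hΩ).aestronglyMeasurable).2 (hreg.model_sq Ω hΩ)

theorem integrable_jacTrace_sub_prior (h : M.BCRBRegular) {Ω₁ Ω₂ : Vec q} {T : Vec p → ℝ}
    (hT : Integrable T M.priorLaw)
    (hJ : ∀ θ ∈ interior M.paramSet, ‖fderiv ℝ (sP Ω₁) θ - fderiv ℝ (sP Ω₂) θ‖ ≤ T θ) :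
    Integrable (fun θ => jacTrace (sP Ω₁) θ - jacTrace (sP Ω₂) θ) M.priorLaw := by
  refine (hT.const_mul (p : ℝ)).mono
    ((measurable_jacTrace _).sub (measurable_jacTrace _)).aestronglyMeasurable ?_
  filter_upwards [ae_priorLaw_mem_interior h] with θ hθ
  rw [Real.norm_eq_abs]
  exact (abs_jacTrace_sub_le _ _ _).trans ((mul_le_mul_of_nonneg_left (hJ θ hθ)
    (Nat.cast_nonneg p)).trans (le_abs_self _))

/-- Integration by parts for the difference of a prior network and the true prior score: the cross
term of the excess prior loss has expectation zero. -/
theorem integral_jacTrace_add_inner_prior (h : M.BCRBRegular) (hreg : M.PriorScoreRegular S sP)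
    {Ω Ω' : Vec q} (hΩ : Ω ∈ S) (hΩ' : Ω' ∈ S)
    (hreal : ∀ θ ∈ interior M.paramSet, 0 < M.prior θ → sP Ω' θ = M.priorScore θ) {T : Vec p → ℝ}
    (hT : Integrable T M.priorLaw)
    (hJ : ∀ θ ∈ interior M.paramSet, ‖fderiv ℝ (sP Ω) θ - fderiv ℝ (sP Ω') θ‖ ≤ T θ) :
    ∫ θ, (jacTrace (sP Ω) θ - jacTrace (sP Ω') θ + inner ℝ (sP Ω θ - sP Ω' θ) (sP Ω' θ))
      ∂M.priorLaw = 0 := by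
  obtain ⟨-, -, hpos, -, -⟩ := exists_common_support h
  have hfd : ∀ θ ∈ interior M.paramSet, fderiv ℝ (fun t => sP Ω t - sP Ω' t) θ =
      fderiv ℝ (sP Ω) θ - fderiv ℝ (sP Ω') θ := fun θ hθ =>
    fderiv_fun_sub (hreg.model_diff Ω hΩ θ hθ) (hreg.model_diff Ω' hΩ' θ hθ)
  have hD := (memLp_priorModel hreg hΩ).sub (memLp_priorModel hreg hΩ')
  have key := setIntegral_weighted_divergence_eq_zero (G := interior M.paramSet) isOpen_interior
    (w := M.prior) (D := fun t => sP Ω t - sP Ω' t) (A := sP Ω') (T := T) M.prior_measurable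
    ((hreg.model_measurable Ω hΩ).sub (hreg.model_measurable Ω' hΩ')) hpos
    (fun θ hθ => differentiableAt_of_log isOpen_interior hpos hθ
      (hreg.prior_diff θ hθ (hpos θ hθ)))
    (fun θ hθ => (hreg.model_diff Ω hΩ θ hθ).sub (hreg.model_diff Ω' hΩ' θ hθ))
    (fun θ hθ => by
      have := ((hreg.boundary Ω hΩ).tendsto_nhdsWithin_interior M.isClosed_paramSet hθ).sub
        ((hreg.boundary Ω' hΩ').tendsto_nhdsWithin_interior M.isClosed_paramSet hθ)
      simpa [smul_sub] using this)
    (fun θ hθ => (hreal θ hθ (hpos θ hθ)).symm)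
    ((integrable_priorLaw_iff h).1 (hD.integrable one_le_two).norm)
    (fun θ hθ => by rw [hfd θ hθ]; exact hJ θ hθ)
    ((integrable_priorLaw_iff h).1 hT)
    ((integrable_priorLaw_iff h).1 (hD.norm.integrable_mul (memLp_priorModel hreg hΩ').norm))
  rw [integral_priorLaw h, ← key]
  refine setIntegral_congr_fun M.measurableSet_interior fun θ hθ => ?_
  have : jacTrace (fun t => sP Ω t - sP Ω' t) θ = jacTrace (sP Ω) θ - jacTrace (sP Ω') θ := by
    rw [jacTrace_sub_eq_sum, jacTrace_eq_sum, hfd θ hθ]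
  simp only [this]

end Prior

end BayesModel

/-! ### Expected excess losses -/

theorem integrable_inner_of_memLp {p : ℕ} {X : Type*} [MeasurableSpace X] {μ : Measure X}
    {f g : X → Vec p} (hf : MemLp f 2 μ) (hg : MemLp g 2 μ) :
    Integrable (fun x => inner ℝ (f x) (g x)) μ := by
  refine (hf.norm.integrable_mul hg.norm).mono
    (hf.aestronglyMeasurable.inner hg.aestronglyMeasurable) (ae_of_all _ fun x => ?_)
  rw [Pi.mul_apply, norm_mul, norm_norm, norm_norm]
  exact norm_inner_le_norm _ _

/-- The pointwise form of `BayesModel.fisherMismatch_le`, with `u`, `v` the Fisher network and the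
true Fisher score, `a`, `b` the prior network and the true prior score, and `t₁`, `t₂` the traces of
the Jacobians of `u` and `v`. The last summand has expectation zero. -/
theorem normSq_sub_le_two_mul_excess {E : Type*} [NormedAddCommGroup E] [InnerProductSpace ℝ E]
    (u v a b : E) (t₁ t₂ : ℝ) :
    ‖u - v‖ ^ 2 ≤
      2 * ((‖u‖ ^ 2 + 2 * inner ℝ u a + 2 * t₁) - (‖v‖ ^ 2 + 2 * inner ℝ v a + 2 * t₂)) +
      4 * ‖a - b‖ ^ 2 + (-4) * (t₁ - t₂ + inner ℝ (u - v) (v + b)) := by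
  -- Expanding this square absorbs the cross term `⟪u - v, a - b⟫`.
  have hsq : 0 ≤ ‖(u - v) + (2 : ℝ) • (a - b)‖ ^ 2 := sq_nonneg _
  have e0 : ‖(2 : ℝ) • (a - b)‖ = 2 * ‖a - b‖ := by rw [norm_smul]; norm_num
  rw [norm_add_sq_real, e0, inner_smul_right, inner_sub_right] at hsq
  have e1 : ‖u‖ ^ 2 - ‖v‖ ^ 2 = ‖u - v‖ ^ 2 + 2 * inner ℝ (u - v) v := by
    rw [norm_sub_sq_real, inner_sub_left, real_inner_self_eq_norm_sq]; ring
  have e2 := inner_sub_left (𝕜 := ℝ) u v a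
  rw [inner_add_right]
  nlinarith [hsq, e1, e2]

theorem integral_le_of_forall_le_combination {X : Type*} [MeasurableSpace X] {μ : Measure X}
    {d l e i : X → ℝ} (hd : Integrable d μ) (hl : Integrable l μ) (he : Integrable e μ)
    (hi : Integrable i μ) (hle : ∀ x, d x ≤ 2 * l x + 4 * e x + (-4) * i x)
    (h0 : ∫ x, i x ∂μ = 0) : ∫ x, d x ∂μ ≤ 2 * ∫ x, l x ∂μ + 4 * ∫ x, e x ∂μ := by
  have h1 : Integrable (fun x => 2 * l x + 4 * e x) μ := (hl.const_mul 2).add (he.const_mul 4)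
  refine (integral_mono hd (h1.add (hi.const_mul (-4))) hle).trans (le_of_eq ?_)
  rw [integral_add' h1 (hi.const_mul (-4)), integral_add (hl.const_mul 2) (he.const_mul 4),
    integral_const_mul, integral_const_mul, integral_const_mul, h0]
  ring

namespace BayesModel

variable {p m : ℕ} {M : BayesModel p m}

section Prior

variable {q : ℕ} {S : Set (Vec q)} {sP : Vec q → Vec p → Vec p}

theorem priorMismatch_eq (h : M.BCRBRegular) {Ω Ω' : Vec q}
    (hreal : ∀ θ ∈ interior M.paramSet, 0 < M.prior θ → sP Ω' θ = M.priorScore θ) :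
    M.priorMismatch sP Ω = ∫ θ, ‖sP Ω θ - sP Ω' θ‖ ^ 2 ∂M.priorLaw := by
  obtain ⟨-, -, hpos, -, -⟩ := exists_common_support h
  refine integral_congr_ae ?_
  filter_upwards [ae_priorLaw_mem_interior h] with θ hθ
  rw [hreal θ hθ (hpos θ hθ)]

theorem integrable_priorLoss_sub (h : M.BCRBRegular) (hreg : M.PriorScoreRegular S sP)
    {Ω Ω' : Vec q} (hΩ : Ω ∈ S) (hΩ' : Ω' ∈ S) {T : Vec p → ℝ} (hT : Integrable T M.priorLaw)
    (hJ : ∀ θ ∈ interior M.paramSet, ‖fderiv ℝ (sP Ω) θ - fderiv ℝ (sP Ω') θ‖ ≤ T θ) :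
    Integrable (fun θ => priorLoss sP θ Ω - priorLoss sP θ Ω') M.priorLaw := by
  have := ((hreg.model_sq Ω hΩ).sub (hreg.model_sq Ω' hΩ')).add
    ((integrable_jacTrace_sub_prior h hT hJ).const_mul 2)
  refine this.congr (ae_of_all _ fun θ => ?_)
  simp only [priorLoss, Pi.add_apply, Pi.sub_apply]
  ring

/-- The expected excess prior loss over the true score is the prior mismatch. -/
theorem integral_priorLoss_sub (h : M.BCRBRegular) (hreg : M.PriorScoreRegular S sP)
    {Ω Ω' : Vec q} (hΩ : Ω ∈ S) (hΩ' : Ω' ∈ S)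
    (hreal : ∀ θ ∈ interior M.paramSet, 0 < M.prior θ → sP Ω' θ = M.priorScore θ) {T : Vec p → ℝ}
    (hT : Integrable T M.priorLaw)
    (hJ : ∀ θ ∈ interior M.paramSet, ‖fderiv ℝ (sP Ω) θ - fderiv ℝ (sP Ω') θ‖ ≤ T θ) :
    ∫ θ, (priorLoss sP θ Ω - priorLoss sP θ Ω') ∂M.priorLaw = M.priorMismatch sP Ω := by
  have hD := (memLp_priorModel hreg hΩ).sub (memLp_priorModel hreg hΩ')
  have hI : Integrable (fun θ => jacTrace (sP Ω) θ - jacTrace (sP Ω') θ +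
      inner ℝ (sP Ω θ - sP Ω' θ) (sP Ω' θ)) M.priorLaw :=
    (integrable_jacTrace_sub_prior h hT hJ).add 
      (integrable_inner_of_memLp hD (memLp_priorModel hreg hΩ'))
  have hsq : Integrable (fun θ => ‖sP Ω θ - sP Ω' θ‖ ^ 2) M.priorLaw :=
    (memLp_two_iff_integrable_sq_norm hD.1).1 hD
  have e : ∀ θ, priorLoss sP θ Ω - priorLoss sP θ Ω' = ‖sP Ω θ - sP Ω' θ‖ ^ 2 +
      2 * (jacTrace (sP Ω) θ - jacTrace (sP Ω') θ + inner ℝ (sP Ω θ - sP Ω' θ) (sP Ω' θ)) := by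
    intro θ
    rw [priorLoss, priorLoss, norm_sub_sq_real, inner_sub_left, real_inner_self_eq_norm_sq]
    ring
  simp_rw [e]
  rw [integral_add hsq (hI.const_mul 2), integral_const_mul,
    integral_jacTrace_add_inner_prior h hreg hΩ hΩ' hreal hT hJ, mul_zero, add_zero,
    priorMismatch_eq h hreal]

end Prior

section Fisher

variable {qF qP : ℕ} {SF : Set (Vec qF)} {sF : Vec qF → Vec m → Vec p → Vec p}
  {SP : Set (Vec qP)} {sP : Vec qP → Vec p → Vec p}

theorem memLp_fisherModel (hreg : M.FisherScoreRegular SF sF) {Ω : Vec qF} (hΩ : Ω ∈ SF) :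
    MemLp (fun z : Vec p × Vec m => sF Ω z.2 z.1) 2 M.jointLaw :=
  (memLp_two_iff_integrable_sq_norm
    (hreg.model_measurable Ω hΩ).aestronglyMeasurable).2 (hreg.model_sq Ω hΩ)

theorem memLp_priorModel_fst (hreg : M.PriorScoreRegular SP sP) {Ω : Vec qP} (hΩ : Ω ∈ SP) :
    MemLp (fun z : Vec p × Vec m => sP Ω z.1) 2 M.jointLaw :=
  (memLp_priorModel hreg hΩ).comp_measurePreserving M.measurePreserving_fst_jointLaw

theorem integrable_jacTrace_sub_fisher (h : M.BCRBRegular) (hreg : M.FisherScoreRegular SF sF)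
    {Ω₁ Ω₂ : Vec qF} (h₁ : Ω₁ ∈ SF) (h₂ : Ω₂ ∈ SF) {T : Vec p × Vec m → ℝ}
    (hT : Integrable T M.jointLaw)
    (hJ : ∀ θ ∈ interior M.paramSet, ∀ x ∈ M.obsSet,
      ‖fderiv ℝ (sF Ω₁ x) θ - fderiv ℝ (sF Ω₂ x) θ‖ ≤ T (θ, x)) :
    Integrable (fun z => jacTrace (sF Ω₁ z.2) z.1 - jacTrace (sF Ω₂ z.2) z.1) M.jointLaw := by
  have hm : ∀ Ω ∈ SF, AEStronglyMeasurable (fun z => jacTrace (sF Ω z.2) z.1) M.jointLaw :=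
    fun Ω hΩ => aestronglyMeasurable_jacTrace_param (hreg.model_measurable Ω hΩ) <| by
      filter_upwards [ae_jointLaw_mem h] with z hz
      exact hreg.model_diff Ω hΩ z.2 hz.2.1 z.1 hz.1
  refine (hT.const_mul (p : ℝ)).mono ((hm Ω₁ h₁).sub (hm Ω₂ h₂)) ?_
  filter_upwards [ae_jointLaw_mem h] with z hz
  rw [Real.norm_eq_abs]
  exact (abs_jacTrace_sub_le _ _ _).trans ((mul_le_mul_of_nonneg_left
    (hJ z.1 hz.1 z.2 hz.2.1) (Nat.cast_nonneg p)).trans (le_abs_self _))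

/-- Integration by parts for the difference of a Fisher network and the true Fisher score. The
logarithmic gradient of the joint density, against which it is tested, is the sum of the Fisher
score and the prior score. -/
theorem integral_jacTrace_add_inner_fisher (h : M.BCRBRegular)
    (hPreg : M.PriorScoreRegular SP sP) (hFreg : M.FisherScoreRegular SF sF)
    {Ω Ω' : Vec qF} (hΩ : Ω ∈ SF) (hΩ' : Ω' ∈ SF) {Ωp : Vec qP} (hΩp : Ωp ∈ SP)
    (hPreal : ∀ θ ∈ interior M.paramSet, 0 < M.prior θ → sP Ωp θ = M.priorScore θ)
    (hFreal : ∀ x ∈ M.obsSet, ∀ θ ∈ interior M.paramSet, 0 < M.joint x θ →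
      sF Ω' x θ = M.fisherScore x θ) {T : Vec p × Vec m → ℝ}
    (hT : Integrable T M.jointLaw)
    (hJ : ∀ θ ∈ interior M.paramSet, ∀ x ∈ M.obsSet,
      ‖fderiv ℝ (sF Ω x) θ - fderiv ℝ (sF Ω' x) θ‖ ≤ T (θ, x)) :
    ∫ z, (jacTrace (sF Ω z.2) z.1 - jacTrace (sF Ω' z.2) z.1 +
      inner ℝ (sF Ω z.2 z.1 - sF Ω' z.2 z.1) (sF Ω' z.2 z.1 + sP Ωp z.1)) ∂M.jointLaw = 0 := by
  obtain ⟨U, hU, hpos, hlik, hzero⟩ := exists_common_support h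
  have hD := (memLp_fisherModel hFreg hΩ).sub (memLp_fisherModel hFreg hΩ')
  have hA := (memLp_fisherModel hFreg hΩ').add (memLp_priorModel_fst hPreg hΩp)
  have hI := (integrable_jacTrace_sub_fisher h hFreg hΩ hΩ' hT hJ).add
    (integrable_inner_of_memLp hD hA)
  have hI' := integral_jointLaw h hI
  simp only [Pi.add_apply, Pi.sub_apply] at hI'
  rw [hI']
  refine integral_eq_zero_of_ae ?_
  filter_upwards [ae_restrict_mem M.obsSet_measurable,
    ae_integrableOn_of_integrable_jointLaw h (hD.integrable one_le_two).norm,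
    ae_integrableOn_of_integrable_jointLaw h hT,
    ae_integrableOn_of_integrable_jointLaw h (hD.norm.integrable_mul hA.norm)] with x hx i1 i2 i3
  rw [Pi.zero_apply]
  -- For observations outside the common support the integrand vanishes identically on `G`.
  by_cases hxU : x ∈ U
  swap
  · rw [setIntegral_congr_fun (g := fun _ => 0) M.measurableSet_interior fun θ hθ => by
      simp [hzero x hx hxU θ hθ]]
    simp
  have hjpos : ∀ θ ∈ interior M.paramSet, 0 < M.joint x θ := fun θ hθ =>
    mul_pos (hlik x hxU θ hθ) (hpos θ hθ)
  have hfd : ∀ θ ∈ interior M.paramSet, fderiv ℝ (fun t => sF Ω x t - sF Ω' x t) θ =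
      fderiv ℝ (sF Ω x) θ - fderiv ℝ (sF Ω' x) θ := fun θ hθ =>
    fderiv_fun_sub (hFreg.model_diff Ω hΩ x hx θ hθ) (hFreg.model_diff Ω' hΩ' x hx θ hθ)
  have hm : ∀ Ω ∈ SF, Measurable (sF Ω x) := fun Ω hΩ =>
    (hFreg.model_measurable Ω hΩ).comp measurable_prodMk_right
  have hgrad : ∀ θ ∈ interior M.paramSet, gradient (fun t => Real.log (M.joint x t)) θ =
      sF Ω' x θ + sP Ωp θ := by
    intro θ hθ
    rw [hFreal x hx θ hθ (hjpos θ hθ), hPreal θ hθ (hpos θ hθ), fisherScore, priorScore, gradient,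
      gradient, gradient, ← map_add, ← fderiv_fun_add (hFreg.lik_diff x hx θ hθ (hjpos θ hθ))
        (hPreg.prior_diff θ hθ (hpos θ hθ))]
    congr 1
    refine Filter.EventuallyEq.fderiv_eq ?_
    filter_upwards [isOpen_interior.mem_nhds hθ] with t ht
    exact Real.log_mul (hlik x hxU t ht).ne' (hpos t ht).ne'
  have key := setIntegral_weighted_divergence_eq_zero (G := interior M.paramSet) isOpen_interior
    (w := M.joint x) (D := fun t => sF Ω x t - sF Ω' x t) (A := fun t => sF Ω' x t + sP Ωp t)
    (T := fun θ => T (θ, x)) (M.measurable_joint.comp measurable_prodMk_right)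
    ((hm Ω hΩ).sub (hm Ω' hΩ')) hjpos
    (fun θ hθ => differentiableAt_of_log isOpen_interior hjpos hθ
      (h.joint_diff x hx θ hθ (hjpos θ hθ)))
    (fun θ hθ => (hFreg.model_diff Ω hΩ x hx θ hθ).sub (hFreg.model_diff Ω' hΩ' x hx θ hθ))
    (fun θ hθ => by
      have := ((hFreg.boundary Ω hΩ x hx).tendsto_nhdsWithin_interior M.isClosed_paramSet hθ).sub
        ((hFreg.boundary Ω' hΩ' x hx).tendsto_nhdsWithin_interior M.isClosed_paramSet hθ)
      simpa [smul_sub] using this)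
    hgrad i1 (fun θ hθ => by rw [hfd θ hθ]; exact hJ θ hθ x hx) i2 i3
  rw [← key]
  refine setIntegral_congr_fun M.measurableSet_interior fun θ hθ => ?_
  have : jacTrace (fun t => sF Ω x t - sF Ω' x t) θ =
      jacTrace (sF Ω x) θ - jacTrace (sF Ω' x) θ := by
    rw [jacTrace_sub_eq_sum, jacTrace_eq_sum, hfd θ hθ]
  simp only [this]

theorem fisherMismatch_eq (h : M.BCRBRegular) {Ω Ω' : Vec qF}
    (hreal : ∀ x ∈ M.obsSet, ∀ θ ∈ interior M.paramSet, 0 < M.joint x θ →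
      sF Ω' x θ = M.fisherScore x θ) :
    M.fisherMismatch sF Ω = ∫ z, ‖sF Ω z.2 z.1 - sF Ω' z.2 z.1‖ ^ 2 ∂M.jointLaw := by
  refine integral_congr_ae ?_
  filter_upwards [ae_jointLaw_mem h] with z hz
  rw [hreal z.2 hz.2.1 z.1 hz.1 hz.2.2]

theorem integrable_fisherLoss_sub (h : M.BCRBRegular)
    (hPreg : M.PriorScoreRegular SP sP) (hFreg : M.FisherScoreRegular SF sF)
    {Ω Ω' : Vec qF} (hΩ : Ω ∈ SF) (hΩ' : Ω' ∈ SF) {ΩP : Vec qP} (hΩP : ΩP ∈ SP)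
    {T : Vec p × Vec m → ℝ} (hT : Integrable T M.jointLaw)
    (hJ : ∀ θ ∈ interior M.paramSet, ∀ x ∈ M.obsSet,
      ‖fderiv ℝ (sF Ω x) θ - fderiv ℝ (sF Ω' x) θ‖ ≤ T (θ, x)) :
    Integrable (fun z => fisherLoss sF sP z.2 z.1 Ω ΩP - fisherLoss sF sP z.2 z.1 Ω' ΩP)
      M.jointLaw := by
  have hD := (memLp_fisherModel hFreg hΩ).sub (memLp_fisherModel hFreg hΩ')
  have := (((hFreg.model_sq Ω hΩ).sub (hFreg.model_sq Ω' hΩ')).add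
    ((integrable_inner_of_memLp hD (memLp_priorModel_fst hPreg hΩP)).const_mul 2)).add
    ((integrable_jacTrace_sub_fisher h hFreg hΩ hΩ' hT hJ).const_mul 2)
  refine this.congr (ae_of_all _ fun z => ?_)
  simp only [fisherLoss, Pi.add_apply, Pi.sub_apply, inner_sub_left]
  ring

/-- The Fisher mismatch is controlled by the expected excess Fisher loss, computed with an arbitrary
prior network, and the mismatch of that prior network. -/
theorem fisherMismatch_le (h : M.BCRBRegular)
    (hPreg : M.PriorScoreRegular SP sP) (hFreg : M.FisherScoreRegular SF sF)
    {Ω Ω' : Vec qF} (hΩ : Ω ∈ SF) (hΩ' : Ω' ∈ SF) {ΩP Ωp : Vec qP} (hΩP : ΩP ∈ SP) (hΩp : Ωp ∈ SP)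
    (hPreal : ∀ θ ∈ interior M.paramSet, 0 < M.prior θ → sP Ωp θ = M.priorScore θ)
    (hFreal : ∀ x ∈ M.obsSet, ∀ θ ∈ interior M.paramSet, 0 < M.joint x θ →
      sF Ω' x θ = M.fisherScore x θ)
    {T : Vec p × Vec m → ℝ} (hT : Integrable T M.jointLaw)
    (hJ : ∀ θ ∈ interior M.paramSet, ∀ x ∈ M.obsSet,
      ‖fderiv ℝ (sF Ω x) θ - fderiv ℝ (sF Ω' x) θ‖ ≤ T (θ, x)) :
    M.fisherMismatch sF Ω ≤
      2 * ∫ z, (fisherLoss sF sP z.2 z.1 Ω ΩP - fisherLoss sF sP z.2 z.1 Ω' ΩP) ∂M.jointLaw +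
        4 * M.priorMismatch sP ΩP := by
  have hD := (memLp_fisherModel hFreg hΩ).sub (memLp_fisherModel hFreg hΩ')
  have hE := (memLp_priorModel hPreg hΩP).sub (memLp_priorModel hPreg hΩp)
  have hA := (memLp_fisherModel hFreg hΩ').add (memLp_priorModel_fst hPreg hΩp)
  have hI := (integrable_jacTrace_sub_fisher h hFreg hΩ hΩ' hT hJ).add
    (integrable_inner_of_memLp hD hA)
  have hL := integrable_fisherLoss_sub h hPreg hFreg hΩ hΩ' hΩP hT hJ
  have hDsq : Integrable (fun z : Vec p × Vec m => ‖sF Ω z.2 z.1 - sF Ω' z.2 z.1‖ ^ 2) M.jointLaw :=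
    (memLp_two_iff_integrable_sq_norm hD.1).1 hD
  have hEsq : Integrable (fun θ => ‖sP ΩP θ - sP Ωp θ‖ ^ 2) M.priorLaw :=
    (memLp_two_iff_integrable_sq_norm hE.1).1 hE
  have hEsq' : Integrable (fun z : Vec p × Vec m => ‖sP ΩP z.1 - sP Ωp z.1‖ ^ 2) M.jointLaw :=
    M.measurePreserving_fst_jointLaw.integrable_comp_of_integrable
      (g := fun θ => ‖sP ΩP θ - sP Ωp θ‖ ^ 2) hEsq
  have hEint : ∫ z : Vec p × Vec m, ‖sP ΩP z.1 - sP Ωp z.1‖ ^ 2 ∂M.jointLaw =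
      M.priorMismatch sP ΩP := by
    rw [priorMismatch_eq h hPreal, ← M.measurePreserving_fst_jointLaw.map_eq,
      integral_map measurable_fst.aemeasurable]
    rw [M.measurePreserving_fst_jointLaw.map_eq]
    exact hEsq.aestronglyMeasurable
  have h0 := integral_jacTrace_add_inner_fisher h hPreg hFreg hΩ hΩ' hΩp hPreal hFreal hT hJ
  rw [fisherMismatch_eq h hFreal, ← hEint]
  exact integral_le_of_forall_le_combination hDsq hL hEsq' hI
    (fun z => normSq_sub_le_two_mul_excess _ _ _ _ _ _) h0

end Fisher
end BayesModel

/-! ### Consistency -/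

theorem exists_norm_sub_le_of_isCompact {q : ℕ} {S : Set (Vec q)} (hS : IsCompact S) :
    ∃ R, ∀ x ∈ S, ∀ y ∈ S, ‖x - y‖ ≤ R := by
  obtain ⟨R, hR⟩ := Metric.isBounded_iff.1 hS.isBounded
  exact ⟨R, fun x hx y hy => by rw [← dist_eq_norm]; exact hR hx hy⟩

theorem abs_inner_sub_inner_le {E : Type*} [NormedAddCommGroup E] [InnerProductSpace ℝ E]
    {s₁ s₂ s q₁ q₂ q : E} {a b d R R' : ℝ} (ha : 0 ≤ a) (hd : 0 ≤ d)
    (h1 : ‖s₁ - s₂‖ ≤ a * d) (h2 : ‖s₂ - s‖ ≤ a * R) (h3 : ‖q₁ - q₂‖ ≤ b * d)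
    (h4 : ‖q₁ - q‖ ≤ b * R') :
    |inner ℝ (s₁ - s) q₁ - inner ℝ (s₂ - s) q₂| ≤ (a * (‖q‖ + b * R') + a * R * b) * d := by
  have e : inner ℝ (s₁ - s) q₁ - inner ℝ (s₂ - s) q₂ =
      inner ℝ (s₁ - s₂) q₁ + inner ℝ (s₂ - s) (q₁ - q₂) := by
    simp only [inner_sub_left, inner_sub_right]; ring
  have hq : ‖q₁‖ ≤ ‖q‖ + b * R' := by
    have := norm_le_norm_add_norm_sub' q₁ q
    linarith
  rw [e]
  calc _ ≤ ‖s₁ - s₂‖ * ‖q₁‖ + ‖s₂ - s‖ * ‖q₁ - q₂‖ :=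
        (abs_add_le _ _).trans (add_le_add (abs_real_inner_le_norm _ _)
          (abs_real_inner_le_norm _ _))
    _ ≤ (a * d) * (‖q‖ + b * R') + (a * R) * (b * d) :=
        add_le_add (mul_le_mul h1 hq (norm_nonneg _) (by positivity))
          (mul_le_mul h2 h3 (norm_nonneg _) ((norm_nonneg _).trans h2))
    _ = _ := by ring

/-- The average of a function of (parameter, observation) over the `K` observations of a record. -/
noncomputable def recordMean {p m K : ℕ} (f : Vec p × Vec m → ℝ) 
    (r : Vec p × (Fin K → Vec m)) : ℝ :=
  (1 / (K : ℝ)) * ∑ j, f (r.1, r.2 j)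

theorem empFisherLoss_eq_recordMean {p m K qF qP : ℕ} (sF : Vec qF → Vec m → Vec p → Vec p)
    (sP : Vec qP → Vec p → Vec p) (data : ℕ → Vec p × (Fin K → Vec m)) (N : ℕ)
    (ΩP : Vec qP) (ΩF : Vec qF) : empFisherLoss sF sP data N ΩP ΩF = (1 / (N : ℝ)) *
      ∑ n ∈ Finset.range N, recordMean (fun z => fisherLoss sF sP z.2 z.1 ΩF ΩP) (data n) := by
  simp only [empFisherLoss, recordMean, ← Finset.mul_sum]
  rw [← mul_assoc, one_div_mul_one_div]

theorem recordMean_sub {p m K : ℕ} (f g : Vec p × Vec m → ℝ) (r : Vec p × (Fin K → Vec m)) :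
    recordMean (fun z => f z - g z) r = recordMean f r - recordMean g r := by
  simp only [recordMean, Finset.sum_sub_distrib, mul_sub]

namespace BayesModel

variable {p m : ℕ} {M : BayesModel p m} {K : ℕ}

theorem measurePreserving_fst_recordLaw (M : BayesModel p m) (hK : 0 < K) :
    MeasurePreserving Prod.fst (M.recordLaw K) M.priorLaw :=
  M.measurePreserving_fst_jointLaw.comp (M.measurePreserving_recordLaw ⟨0, hK⟩)

theorem integrable_recordMean {f : Vec p × Vec m → ℝ} (hf : Integrable f M.jointLaw) :
    Integrable (recordMean f) (M.recordLaw K) :=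
  (integrable_finsetSum _ fun j _ =>
    (M.measurePreserving_recordLaw j).integrable_comp_of_integrable hf).const_mul _

theorem integral_recordMean (hK : 0 < K) {f : Vec p × Vec m → ℝ} (hf : Integrable f M.jointLaw) :
    ∫ r, recordMean f r ∂M.recordLaw K = ∫ z, f z ∂M.jointLaw := by
  have h1 : ∀ j : Fin K, ∫ r, f (r.1, r.2 j) ∂M.recordLaw K = ∫ z, f z ∂M.jointLaw := fun j => by
    have hp := M.measurePreserving_recordLaw j
    rw [← hp.map_eq, integral_map hp.measurable.aemeasurable
      (by rw [hp.map_eq]; exact hf.aestronglyMeasurable)]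
  have h2 := integral_finsetSum Finset.univ fun (j : Fin K) _ =>
    (M.measurePreserving_recordLaw j).integrable_comp_of_integrable hf
  simp only [Function.comp_def, h1] at h2
  unfold recordMean
  rw [integral_const_mul, h2]
  have : (K : ℝ) ≠ 0 := by positivity
  simp [this]

section Consistency

variable {qF qP : ℕ} {SF : Set (Vec qF)} {sF : Vec qF → Vec m → Vec p → Vec p}
  {SP : Set (Vec qP)} {sP : Vec qP → Vec p → Vec p}
  {Ω₀ : Type*} [MeasurableSpace Ω₀] {P : Measure Ω₀} [IsProbabilityMeasure P]
  {data : ℕ → Ω₀ → Vec p × (Fin K → Vec m)}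

theorem priorMismatch_nonneg (Ω : Vec qP) : 0 ≤ M.priorMismatch sP Ω :=
  integral_nonneg fun _ => sq_nonneg _

theorem fisherMismatch_nonneg (Ω : Vec qF) : 0 ≤ M.fisherMismatch sF Ω :=
  integral_nonneg fun _ => sq_nonneg _

theorem ae_tendsto_priorMismatch (hK : 0 < K) (hSP : IsCompact SP)
    (hreg : M.BCRBRegular) (hPreg : M.PriorScoreRegular SP sP)
    (hPlip : M.PriorLipschitz SP sP) (hPreal : M.PriorRealizable SP sP)
    (hm : ∀ n, Measurable (data n)) (hind : iIndepFun data P)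
    (hlaw : ∀ n, P.map (data n) = M.recordLaw K) {ΩP : ℕ → Ω₀ → Vec qP}
    (hΩP : ∀ᵐ ω ∂P, ∀ N, 0 < N → ΩP N ω ∈ SP ∧
      IsMinOn (empPriorLoss sP (fun n => data n ω) N) SP (ΩP N ω)) :
    ∀ᵐ ω ∂P, Tendsto (fun N => M.priorMismatch sP (ΩP N ω)) atTop (𝓝 0) := by
  obtain ⟨Ω', hΩ', hreal⟩ := hPreal
  obtain ⟨ξ, τ, ζ, hlip, -, hτ, hζ⟩ := hPlip
  have hmp := M.measurePreserving_fst_recordLaw hK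
  have hJ : ∀ Ω ∈ SP, ∀ θ ∈ interior M.paramSet,
      ‖fderiv ℝ (sP Ω) θ - fderiv ℝ (sP Ω') θ‖ ≤ τ θ * ‖Ω - Ω'‖ := fun Ω hΩ θ hθ =>
    (hlip θ hθ Ω hΩ Ω' hΩ').2.1
  have hint : ∀ Ω ∈ SP, Integrable (fun θ => priorLoss sP θ Ω - priorLoss sP θ Ω') M.priorLaw :=
    fun Ω hΩ => integrable_priorLoss_sub hreg hPreg hΩ hΩ' (hτ.mul_const _) (hJ Ω hΩ)
  have hintegral : ∀ Ω ∈ SP, ∫ r, (priorLoss sP r.1 Ω - priorLoss sP r.1 Ω') ∂M.recordLaw K =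
      M.priorMismatch sP Ω := by
    intro Ω hΩ
    rw [← integral_priorLoss_sub hreg hPreg hΩ hΩ' hreal (hτ.mul_const _) (hJ Ω hΩ), ← hmp.map_eq,
      integral_map hmp.measurable.aemeasurable
      (by rw [hmp.map_eq]; exact (hint Ω hΩ).aestronglyMeasurable)]
  have hκ : Integrable (fun θ => p * ζ θ + 2 * (p * τ θ)) M.priorLaw :=
    (hζ.const_mul _).add ((hτ.const_mul _).const_mul 2)
  have hulln := ae_eventually_forall_abs_average_sub_le hm hind hlaw hSP
    (h := fun Ω r => priorLoss sP r.1 Ω - priorLoss sP r.1 Ω')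
    (κ := fun r => p * ζ r.1 + 2 * (p * τ r.1))
    (fun Ω hΩ => hmp.integrable_comp_of_integrable
      (g := fun θ => priorLoss sP θ Ω - priorLoss sP θ Ω') (hint Ω hΩ))
    (hmp.integrable_comp_of_integrable (g := fun θ => p * ζ θ + 2 * (p * τ θ)) hκ) (by
      filter_upwards [hmp.quasiMeasurePreserving.ae (ae_priorLaw_mem_interior hreg)]
        with r hr Ω₁ h₁ Ω₂ h₂
      obtain ⟨-, l2, l3⟩ := hlip r.1 hr Ω₁ h₁ Ω₂ h₂
      rw [sub_sub_sub_cancel_right, dist_eq_norm]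
      have e : priorLoss sP r.1 Ω₁ - priorLoss sP r.1 Ω₂ = (‖sP Ω₁ r.1‖ ^ 2 - ‖sP Ω₂ r.1‖ ^ 2) +
          2 * (jacTrace (sP Ω₁) r.1 - jacTrace (sP Ω₂) r.1) := by
        simp only [priorLoss]; ring
      rw [e]
      have a1 := (abs_normSq_sub_le (sP Ω₁ r.1) (sP Ω₂ r.1)).trans
        (mul_le_mul_of_nonneg_left l3 (Nat.cast_nonneg p))
      have a2 := (abs_jacTrace_sub_le (sP Ω₁) (sP Ω₂) r.1).trans
        (mul_le_mul_of_nonneg_left l2 (Nat.cast_nonneg p))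
      refine (abs_add_le _ _).trans ?_
      rw [abs_mul, abs_two]
      linarith)
  filter_upwards [hulln, hΩP] with ω h1 h2
  rw [Metric.tendsto_atTop']
  intro ε hε
  obtain ⟨N₀, hN₀⟩ := eventually_atTop.1 (h1 (ε / 2) (by positivity))
  refine ⟨N₀, fun N hN => ?_⟩
  obtain ⟨hmem, hmin⟩ := h2 N (by omega)
  have h3 := (abs_le.1 (hN₀ N hN.le _ hmem)).1
  rw [hintegral _ hmem, Finset.sum_sub_distrib, mul_sub] at h3
  have h4 := isMinOn_iff.1 hmin Ω' hΩ'
  simp only [empPriorLoss] at h4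
  rw [Real.dist_eq, sub_zero, abs_of_nonneg (priorMismatch_nonneg _)]
  linarith

/-- The excess Fisher loss is Lipschitz jointly in the parameters of the Fisher and prior networks,
with an integrable Lipschitz constant. -/
theorem exists_lipschitz_fisherLoss_sub (hSF : IsCompact SF) (hSP : IsCompact SP)
    (hPreg : M.PriorScoreRegular SP sP)
    (hPlip : M.PriorLipschitz SP sP) (hFlip : M.FisherLipschitz SF sF) {Ω' : Vec qF}
    (hΩ' : Ω' ∈ SF) (hne : SP.Nonempty) :
    ∃ κ : Vec p × Vec m → ℝ, Integrable κ M.jointLaw ∧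
      ∀ θ ∈ interior M.paramSet, ∀ x ∈ M.obsSet, ∀ t₁ ∈ SF ×ˢ SP, ∀ t₂ ∈ SF ×ˢ SP,
        |(fisherLoss sF sP x θ t₁.1 t₁.2 - fisherLoss sF sP x θ Ω' t₁.2) -
          (fisherLoss sF sP x θ t₂.1 t₂.2 - fisherLoss sF sP x θ Ω' t₂.2)| ≤
          κ (θ, x) * dist t₁ t₂ := by
  obtain ⟨Ωp, hΩp⟩ := hne
  obtain ⟨ξP, τP, ζP, hlipP, hξP, -, -⟩ := hPlip
  obtain ⟨ξ, τ, ζ, hlip, hξ, hτ, hζ⟩ := hFlip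
  obtain ⟨R, hR⟩ := exists_norm_sub_le_of_isCompact hSF
  obtain ⟨R', hR'⟩ := exists_norm_sub_le_of_isCompact hSP
  have hξP' : MemLp (fun z : Vec p × Vec m => |ξP z.1|) 2 M.jointLaw :=
    (hξP.comp_measurePreserving M.measurePreserving_fst_jointLaw).norm
  have hq := (memLp_priorModel_fst (m := m) hPreg hΩp).norm
  have hξ' : MemLp (fun z : Vec p × Vec m => |ξ z|) 2 M.jointLaw := hξ.norm
  -- The first two terms come from the squared norms and the Jacobian traces, the last one from the
  -- product with the prior network, bounded through `abs_inner_sub_inner_le`.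
  refine ⟨fun z => (p * |ζ z| + 2 * (p * |τ z|)) + 2 * (|ξ z| * (‖sP Ωp z.1‖ + |ξP z.1| * R') +
    |ξ z| * R * |ξP z.1|), ?_, ?_⟩
  · refine ((hζ.abs.const_mul _).add ((hτ.abs.const_mul _).const_mul 2)).add
      (Integrable.const_mul (Integrable.add ?_ ?_) 2)
    · exact hξ'.integrable_mul (hq.add (hξP'.mul_const R'))
    · exact (hξ'.mul_const R).integrable_mul hξP'
  · rintro θ hθ x hx ⟨a₁, b₁⟩ ⟨ha₁, hb₁⟩ ⟨a₂, b₂⟩ ⟨ha₂, hb₂⟩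
    have hda : ‖a₁ - a₂‖ ≤ dist (a₁, b₁) (a₂, b₂) := by
      rw [← dist_eq_norm]; exact le_max_left _ _
    have hdb : ‖b₁ - b₂‖ ≤ dist (a₁, b₁) (a₂, b₂) := by
      rw [← dist_eq_norm]; exact le_max_right _ _
    set d := dist (a₁, b₁) (a₂, b₂) with hd
    have hd0 : 0 ≤ d := dist_nonneg
    have up : ∀ {c n D : ℝ}, 0 ≤ n → n ≤ D → c * n ≤ |c| * D := fun h0 h1 =>
      mul_le_mul (le_abs_self _) h1 h0 (abs_nonneg _)
    obtain ⟨l1, l2, l3⟩ := hlip (θ, x) ⟨hθ, hx⟩ a₁ ha₁ a₂ ha₂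
    obtain ⟨l4, -, -⟩ := hlip (θ, x) ⟨hθ, hx⟩ a₂ ha₂ Ω' hΩ'
    have l5 := (hlipP θ hθ b₁ hb₁ b₂ hb₂).1
    have l6 := (hlipP θ hθ b₁ hb₁ Ωp hΩp).1
    have a1 := (abs_normSq_sub_le (sF a₁ x θ) (sF a₂ x θ)).trans
      (mul_le_mul_of_nonneg_left (l3.trans (up (norm_nonneg _) hda)) (Nat.cast_nonneg p))
    have a2 := (abs_jacTrace_sub_le (sF a₁ x) (sF a₂ x) θ).trans
      (mul_le_mul_of_nonneg_left (l2.trans (up (norm_nonneg _) hda)) (Nat.cast_nonneg p))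
    have a3 := abs_inner_sub_inner_le (abs_nonneg (ξ (θ, x))) hd0
      (l1.trans (up (norm_nonneg _) hda)) (l4.trans (up (norm_nonneg _) (hR a₂ ha₂ Ω' hΩ')))
      (l5.trans (up (norm_nonneg _) hdb)) (l6.trans (up (norm_nonneg _) (hR' b₁ hb₁ Ωp hΩp)))
    have e : (fisherLoss sF sP x θ a₁ b₁ - fisherLoss sF sP x θ Ω' b₁) -
        (fisherLoss sF sP x θ a₂ b₂ - fisherLoss sF sP x θ Ω' b₂) =
        (‖sF a₁ x θ‖ ^ 2 - ‖sF a₂ x θ‖ ^ 2) + 2 * (jacTrace (sF a₁ x) θ - jacTrace (sF a₂ x) θ) +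
        2 * (inner ℝ (sF a₁ x θ - sF Ω' x θ) (sP b₁ θ) -
          inner ℝ (sF a₂ x θ - sF Ω' x θ) (sP b₂ θ)) := by
      simp only [fisherLoss, inner_sub_left]; ring
    rw [e]
    refine (abs_add_le _ _).trans ((add_le_add (abs_add_le _ _) le_rfl).trans ?_)
    rw [abs_mul, abs_two, abs_mul, abs_two]
    linarith

theorem ae_tendsto_fisherMismatch (hK : 0 < K) (hSF : IsCompact SF) (hSP : IsCompact SP)
    (hreg : M.BCRBRegular)
    (hPreg : M.PriorScoreRegular SP sP) (hFreg : M.FisherScoreRegular SF sF)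
    (hPlip : M.PriorLipschitz SP sP) (hFlip : M.FisherLipschitz SF sF)
    (hPreal : M.PriorRealizable SP sP) (hFreal : M.FisherRealizable SF sF)
    (hm : ∀ n, Measurable (data n)) (hind : iIndepFun data P)
    (hlaw : ∀ n, P.map (data n) = M.recordLaw K) {ΩF : ℕ → Ω₀ → Vec qF} {ΩP : ℕ → Ω₀ → Vec qP}
    (hmem : ∀ᵐ ω ∂P, ∀ N, 0 < N → ΩP N ω ∈ SP)
    (hcons : ∀ᵐ ω ∂P, Tendsto (fun N => M.priorMismatch sP (ΩP N ω)) atTop (𝓝 0))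
    (hΩF : ∀ᵐ ω ∂P, ∀ N, 0 < N → ΩF N ω ∈ SF ∧
      IsMinOn (empFisherLoss sF sP (fun n => data n ω) N (ΩP N ω)) SF (ΩF N ω)) :
    ∀ᵐ ω ∂P, Tendsto (fun N => M.fisherMismatch sF (ΩF N ω)) atTop (𝓝 0) := by
  obtain ⟨Ωp, hΩp, hrealP⟩ := hPreal
  obtain ⟨Ω', hΩ', hrealF⟩ := hFreal
  obtain ⟨κ, hκ, hκlip⟩ := exists_lipschitz_fisherLoss_sub hSF hSP hPreg hPlip hFlip hΩ' ⟨Ωp, hΩp⟩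
  obtain ⟨ξ, τ, ζ, hlip, -, hτ, -⟩ := hFlip
  have hJ : ∀ Ω ∈ SF, ∀ θ ∈ interior M.paramSet, ∀ x ∈ M.obsSet,
      ‖fderiv ℝ (sF Ω x) θ - fderiv ℝ (sF Ω' x) θ‖ ≤ τ (θ, x) * ‖Ω - Ω'‖ := fun Ω hΩ θ hθ x hx =>
    (hlip (θ, x) ⟨hθ, hx⟩ Ω hΩ Ω' hΩ').2.1
  have hint : ∀ t ∈ SF ×ˢ SP, Integrable (fun z : Vec p × Vec m =>
      fisherLoss sF sP z.2 z.1 t.1 t.2 - fisherLoss sF sP z.2 z.1 Ω' t.2) M.jointLaw :=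
    fun t ht => integrable_fisherLoss_sub hreg hPreg hFreg ht.1 hΩ' ht.2 (hτ.mul_const _)
      (hJ t.1 ht.1)
  have hle : ∀ t ∈ SF ×ˢ SP, M.fisherMismatch sF t.1 ≤ 2 * ∫ z, (fisherLoss sF sP z.2 z.1 t.1 t.2 -
      fisherLoss sF sP z.2 z.1 Ω' t.2) ∂M.jointLaw + 4 * M.priorMismatch sP t.2 := fun t ht =>
    fisherMismatch_le hreg hPreg hFreg ht.1 hΩ' ht.2 hΩp hrealP hrealF (hτ.mul_const _)
      (hJ t.1 ht.1)
  have hulln := ae_eventually_forall_abs_average_sub_le hm hind hlaw (hSF.prod hSP)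
    (h := fun t => recordMean fun z =>
      fisherLoss sF sP z.2 z.1 t.1 t.2 - fisherLoss sF sP z.2 z.1 Ω' t.2)
    (κ := recordMean κ) (fun t ht => integrable_recordMean (hint t ht))
    (integrable_recordMean hκ) (by
      have : ∀ᵐ r ∂M.recordLaw K, ∀ j, r.1 ∈ interior M.paramSet ∧ r.2 j ∈ M.obsSet ∧
          0 < M.joint (r.2 j) r.1 := ae_all_iff.2 fun j =>
        (M.measurePreserving_recordLaw j).quasiMeasurePreserving.ae (ae_jointLaw_mem hreg)
      filter_upwards [this] with r hr t₁ h₁ t₂ h₂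
      rw [← recordMean_sub]
      unfold recordMean
      rw [abs_mul, abs_of_nonneg (by positivity), mul_assoc, Finset.sum_mul]
      refine mul_le_mul_of_nonneg_left ((Finset.abs_sum_le_sum_abs _ _).trans
        (Finset.sum_le_sum fun j _ => ?_)) (by positivity)
      exact hκlip r.1 (hr j).1 (r.2 j) (hr j).2.1 t₁ h₁ t₂ h₂)
  filter_upwards [hulln, hmem, hcons, hΩF] with ω h1 h2 h3 h4
  rw [Metric.tendsto_atTop']
  intro ε hε
  -- With these two bounds the Fisher mismatch is at most `2 * (ε / 8) + 4 * (ε / 16) = ε / 2`.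
  obtain ⟨N₀, hN₀⟩ := eventually_atTop.1 ((h1 (ε / 8) (by positivity)).and
    (h3.eventually (gt_mem_nhds (show (0 : ℝ) < ε / 16 by positivity))))
  refine ⟨N₀, fun N hN => ?_⟩
  obtain ⟨hF, hmin⟩ := h4 N (by omega)
  have ht : (ΩF N ω, ΩP N ω) ∈ SF ×ˢ SP := ⟨hF, h2 N (by omega)⟩
  obtain ⟨h5, h6⟩ := hN₀ N hN.le
  have h7 := (abs_le.1 (h5 _ ht)).1
  rw [integral_recordMean hK (hint _ ht)] at h7
  simp only [recordMean_sub] at h7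
  rw [Finset.sum_sub_distrib, mul_sub] at h7
  have h8 := isMinOn_iff.1 hmin Ω' hΩ'
  rw [empFisherLoss_eq_recordMean, empFisherLoss_eq_recordMean] at h8
  have h9 := hle _ ht
  simp only at h9
  rw [Real.dist_eq, sub_zero, abs_of_nonneg (fisherMismatch_nonneg _)]
  linarith

end Consistency
end BayesModel

end ScoreMatching

theorem mainTheorem10 {p m qF qP K : ℕ} (hK : 0 < K) (M : BayesModel p m)
    (SF : Set (Vec qF)) (SP : Set (Vec qP))
    (sF : Vec qF → Vec m → Vec p → Vec p) (sP : Vec qP → Vec p → Vec p)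
    (hSF : IsCompact SF) (hSP : IsCompact SP)
    (hreg : M.BCRBRegular)
    (hPreg : M.PriorScoreRegular SP sP) (hFreg : M.FisherScoreRegular SF sF)
    (hPlip : M.PriorLipschitz SP sP) (hFlip : M.FisherLipschitz SF sF)
    (hPreal : M.PriorRealizable SP sP) (hFreal : M.FisherRealizable SF sF)
    {Ω₀ : Type*} [MeasurableSpace Ω₀] (P : Measure Ω₀) [IsProbabilityMeasure P]
    (data : ℕ → Ω₀ → Vec p × (Fin K → Vec m))
    (hdata_meas : ∀ n, Measurable (data n))
    (hdata_indep : iIndepFun data P)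
    (hdata_law : ∀ n, P.map (data n) = M.recordLaw K)
    (ΩF : ℕ → Ω₀ → Vec qF) (ΩP : ℕ → Ω₀ → Vec qP)
    (hΩP : ∀ᵐ ω ∂P, ∀ N, 0 < N → ΩP N ω ∈ SP ∧
      IsMinOn (empPriorLoss sP (fun n => data n ω) N) SP (ΩP N ω))
    (hΩF : ∀ᵐ ω ∂P, ∀ N, 0 < N → ΩF N ω ∈ SF ∧
      IsMinOn (empFisherLoss sF sP (fun n => data n ω) N (ΩP N ω)) SF (ΩF N ω)) :
    (∀ᵐ ω ∂P, Tendsto (fun N => M.fisherMismatch sF (ΩF N ω)) atTop (𝓝 0)) ∧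
      (∀ᵐ ω ∂P, Tendsto (fun N => M.priorMismatch sP (ΩP N ω)) atTop (𝓝 0)) := by
  have hprior := BayesModel.ae_tendsto_priorMismatch hK hSP hreg hPreg hPlip hPreal hdata_meas
    hdata_indep hdata_law hΩP
  refine ⟨BayesModel.ae_tendsto_fisherMismatch hK hSF hSP hreg hPreg hFreg hPlip hFlip hPreal hFreal
    hdata_meas hdata_indep hdata_law ?_ hprior hΩF, hprior⟩
  filter_upwards [hΩP] with ω hω N hN using (hω N hN).1
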